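/- \textbf{Conventions.} A continuum is a nonempty compact connected metrizable space. For a point $x$ of a space $X$, the order $\operatorname{ord}(x,X)$ is the least cardinal $\kappa$ such that every open neighborhood $U$ of $x$ contains an open neighborhood $V$ of $x$ whose boundary has at most $\kappa$ points. $E(X)=\{x\in X:\operatorname{ord}(x,X)=1\}$ is the set of endpoints of $X$ and $B(X)=\{x\in X:\operatorname{ord}(x,X)\ge 3\}$ the set of branchpoints of $X$. An arc is a space homeomorphic to $[0,1]$. An arc $\alpha\subseteq X$ is a free arc in $X$ if its interior $\alpha^\circ=\alpha\setminus E(\alpha)$ is open in $X$. A finite graph is a continuum that is the union of finitely many arcs, any two of which are either disjoint or intersect only in one or both of their endpoints. A tame partition for a continuum $G$ is a countable family of free arcs in $G$ whose interiors $\alpha^\circ$ are pairwise disjoint and whose union has countable complement in $G$. Countable means finite (possibly empty) or countably infinite. \textbf{Theorem.} The following conditions are equivalent for a continuum $G$: \begin{itemize} \item[(i)] $G$ is a tame graph, that is, the closure of $E(G)\cup B(G)$ is countable. \item[(ii)] $G$ is the union of countably many free arcs and a countable set. \item[(iii)] $G$ admits a tame partition. \item[(iv)] Each point of $G$, with at most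 countably many exceptions, has a neighborhood that is a finite graph. \end{itemize} -/

import Mathlib

open Set Topology unitInterval

universe u

namespace TameGraph

/-- The (Menger–Urysohn) order `ord(x, X)` of a point `x` in a space `X`: the least cardinal `κ`
such that every open neighborhood `U` of `x` contains an open neighborhood `V` of `x` whose
boundary has cardinality at most `κ`. -/
noncomputable def ord {X : Type u} [TopologicalSpace X] (x : X) : Cardinal.{u} :=
  sInf {κ : Cardinal.{u} | ∀ U : Set X, IsOpen U → x ∈ U →
    ∃ V : Set X, IsOpen V ∧ x ∈ V ∧ V ⊆ U ∧ Cardinal.mk (frontier V) ≤ κ}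

/-- The infimum in the definition of the order is over a nonempty set and is attained. -/
theorem ord_le_iff {X : Type u} [TopologicalSpace X] (x : X) (κ : Cardinal.{u}) :
    ord x ≤ κ ↔ ∀ U : Set X, IsOpen U → x ∈ U →
      ∃ V : Set X, IsOpen V ∧ x ∈ V ∧ V ⊆ U ∧ Cardinal.mk (frontier V) ≤ κ := by
  constructor
  · intro h U hU hx
    have hne : {κ : Cardinal.{u} | ∀ U : Set X, IsOpen U → x ∈ U →
        ∃ V : Set X, IsOpen V ∧ x ∈ V ∧ V ⊆ U ∧ Cardinal.mk (frontier V) ≤ κ}.Nonempty :=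
      ⟨Cardinal.mk X, fun U hU hx => ⟨U, hU, hx, Subset.rfl, Cardinal.mk_set_le _⟩⟩
    obtain ⟨V, h1, h2, h3, h4⟩ := csInf_mem hne U hU hx
    exact ⟨V, h1, h2, h3, h4.trans h⟩
  · intro h
    exact csInf_le' h

/-- `E(X)`: the endpoints of `X`, i.e. the points of order one. -/
def endpoints (X : Type u) [TopologicalSpace X] : Set X :=
  {x | ord x = 1}

/-- `B(X)`: the branchpoints of `X`, i.e. the points of order at least three. -/
def branchpoints (X : Type u) [TopologicalSpace X] : Set X :=
  {x | 3 ≤ ord x}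

/-- `E(α)` for a subset `α` of `X`: the endpoints of the subspace `α`, as a subset of `X`. -/
def endpointsOf {X : Type u} [TopologicalSpace X] (α : Set X) : Set X :=
  Subtype.val '' endpoints α

/-- An arc: a subspace homeomorphic to the closed unit interval. -/
def IsArc {X : Type u} [TopologicalSpace X] (α : Set X) : Prop :=
  Nonempty (I ≃ₜ α)

/-- `α° = α \ E(α)`. -/
def arcInterior {X : Type u} [TopologicalSpace X] (α : Set X) : Set X :=
  α \ endpointsOf α

/-- A free arc in `X`: an arc `α` such that `α°` is open in `X`. -/
def IsFreeArc {X : Type u} [TopologicalSpace X] (α : Set X) : Prop :=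
  IsArc α ∧ IsOpen (arcInterior α)

/-- A finite graph: a connected space that is the union of finitely many arcs, any two of which
are disjoint or intersect only in one or both of their endpoints. -/
def IsFiniteGraph {X : Type u} [TopologicalSpace X] (S : Set X) : Prop :=
  IsConnected S ∧ ∃ 𝒜 : Set (Set X), 𝒜.Finite ∧ (∀ α ∈ 𝒜, IsArc α) ∧
    (∀ α ∈ 𝒜, ∀ β ∈ 𝒜, α ≠ β → α ∩ β ⊆ endpointsOf α ∩ endpointsOf β) ∧ ⋃₀ 𝒜 = S

/-- A tame graph (for a continuum `G`): the closure of `E(G) ∪ B(G)` is countable. -/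
def IsTameGraph (G : Type u) [TopologicalSpace G] : Prop :=
  (closure (endpoints G ∪ branchpoints G)).Countable

/-- A tame partition: a countable family of free arcs with pairwise disjoint interiors covering
the space up to a countable set of points. -/
def IsTamePartition {G : Type u} [TopologicalSpace G] (P : Set (Set G)) : Prop :=
  P.Countable ∧ (∀ α ∈ P, IsFreeArc α) ∧
    (∀ α ∈ P, ∀ β ∈ P, α ≠ β → Disjoint (arcInterior α) (arcInterior β)) ∧ (⋃₀ P)ᶜ.Countable

end TameGraph

/-! Let `W = freeInterior G` be the open union of the interiors of all free arcs. Each of the four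
conditions amounts to `W` having countable complement.

A point of `W` has order two, so `E(G) ∪ B(G)` lies in the closed complement of `W`, and
countability of that complement gives (i). For the converse, suppose that all points near `x` have
order two. Consider a continuum `K` irreducible between `a ≠ b` whose points have order at most two
in `G`, and a small open set `D` around a point of `K` other than `a`, `b`, with at most two
boundary points. Irreducibility forces `K \ D` to split into two continua, one containing `a` and
one containing `b`, with both boundary points of `D` on `K`
(`IsIrreducibleBetween.exists_partition`). Hence every such point separates `a` from `b` in `K`, so
`K` is an arc by the classical ordering argument; also, nothing outside `K` accumulates at these
points, so `K` is free (`IsIrreducibleBetween.isOpen_diff`). Boundary bumping starts such an arc at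
`x`; as `x` is not an endpoint of `G`, the arc can be continued beyond `x`
(`mem_freeInterior_of_hasSmallBoundaries`).

The rest is countability: by the Lindelöf property countably many arcs or graphs suffice, and their
endpoints form a countable set. A tame partition arises by removing from each arc the earlier ones
and cutting the open remainder into dyadic subarcs. -/

namespace TameGraph

/-! ### Connectedness, irreducible continua and boundary bumping -/

section GeneralTopology

variable {X : Type u} [TopologicalSpace X]

theorem inter_frontier_nonempty_of_isPreconnected {S D : Set X} (hS : IsPreconnected S)
    (h1 : (S ∩ D).Nonempty) (h2 : (S \ D).Nonempty) : (S ∩ frontier D).Nonempty := by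
  by_contra hne
  have key : ∀ x ∈ S, x ∉ frontier D := fun x hx hf => hne ⟨x, hx, hf⟩
  obtain ⟨x, hxS, hxD⟩ := h1
  obtain ⟨y, hyS, hyD⟩ := h2
  obtain ⟨z, -, hz1, hz2⟩ := hS (interior D) (closure D)ᶜ isOpen_interior
    isClosed_closure.isOpen_compl
    (fun z hz => by
      by_contra hcon
      rw [mem_union, not_or] at hcon
      exact key z hz ⟨not_not.1 hcon.2, hcon.1⟩)
    ⟨x, hxS, by
      by_contra hcon
      exact key x hxS ⟨subset_closure hxD, hcon⟩⟩
    ⟨y, hyS, fun hcon => key y hyS ⟨hcon, fun hi => hyD (interior_subset hi)⟩⟩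
  exact hz2 (subset_closure (interior_subset hz1))

/-- If a connected set is the union of two closed sets meeting in at most the point `c`, the
piece containing `c` is connected. -/
theorem isPreconnected_of_union_of_inter_subset_singleton {K A B : Set X} {c : X}
    (hK : IsPreconnected K) (hA : IsClosed A) (hB : IsClosed B) (hKAB : K = A ∪ B)
    (hAB : A ∩ B ⊆ {c}) (hc : c ∈ A) : IsPreconnected A := by
  classical
  -- Collapsing `B` to `c` retracts `K` onto `A`; the map is continuous because the two closed
  -- pieces meet at most in `c`.
  have hAimg : (fun x => if x ∈ A then x else c) '' K = A := by
    ext y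
    constructor
    · rintro ⟨x, -, rfl⟩
      dsimp only
      split_ifs with h
      exacts [h, hc]
    · intro hy
      exact ⟨y, hKAB ▸ Or.inl hy, if_pos hy⟩
  rw [← hAimg]
  refine hK.image _ ?_
  rw [hKAB]
  refine ContinuousOn.union_of_isClosed ?_ ?_ hA hB
  · exact continuousOn_id.congr fun x hx => if_pos hx
  · refine (continuousOn_const (c := c)).congr fun x hx => ?_
    dsimp only
    split_ifs with h
    · exact hAB ⟨h, hx⟩
    · rfl

/-- Disjoint closed pieces of the intersection have disjoint open neighborhoods, and by compactness
a single member of the chain already lies in their union. -/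
theorem isPreconnected_sInter_of_isChain [CompactSpace X] [T2Space X] {c : Set (Set X)}
    (hc : IsChain (· ⊆ ·) c) (hne : c.Nonempty) (hcl : ∀ M ∈ c, IsClosed M)
    (hconn : ∀ M ∈ c, IsPreconnected M) : IsPreconnected (⋂₀ c) := by
  rw [isPreconnected_iff_subset_of_fully_disjoint_closed (isClosed_sInter hcl)]
  intro u v hu hv huv hd
  obtain ⟨O₁, O₂, hO₁, hO₂, huO, hvO, hO⟩ := SeparatedNhds.of_isCompact_isCompact
    hu.isCompact hv.isCompact hd
  have : Nonempty c := hne.to_subtype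
  obtain ⟨M, hM⟩ := exists_subset_nhds_of_compactSpace (V := fun M : c => (M : Set X))
    (U := O₁ ∪ O₂)
    (fun s t => (hc.total s.2 t.2).elim (fun h => ⟨s, Subset.rfl, h⟩) fun h => ⟨t, h, Subset.rfl⟩)
    (fun M => hcl M M.2) (fun x hx => (hO₁.union hO₂).mem_nhds
      ((union_subset_union huO hvO) (huv (by rwa [sInter_eq_iInter]))))
  have hsub : ⋂₀ c ⊆ M := sInter_subset_of_mem M.2
  rcases (hconn M M.2).subset_or_subset hO₁ hO₂ hO hM with h | h
  · left
    intro x hx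
    rcases huv hx with h' | h'
    · exact h'
    · exact (disjoint_left.1 hO (h (hsub hx)) (hvO h')).elim
  · right
    intro x hx
    rcases huv hx with h' | h'
    · exact (disjoint_left.1 hO (huO h') (h (hsub hx))).elim
    · exact h'

/-- `K` is a closed connected set containing `a` and `b` and minimal with this property. -/
structure IsIrreducibleBetween (a b : X) (K : Set X) : Prop where
  isClosed : IsClosed K
  isPreconnected : IsPreconnected K
  left_mem : a ∈ K
  right_mem : b ∈ K
  eq_of_subset : ∀ M ⊆ K, IsClosed M → IsPreconnected M → a ∈ M → b ∈ M → M = K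

theorem IsIrreducibleBetween.symm {a b : X} {K : Set X} (h : IsIrreducibleBetween a b K) :
    IsIrreducibleBetween b a K :=
  ⟨h.1, h.2, h.4, h.3, fun M h1 h2 h3 h4 h5 => h.5 M h1 h2 h3 h5 h4⟩

theorem exists_isIrreducibleBetween [CompactSpace X] [T2Space X] {a b : X} {M : Set X}
    (hM : IsClosed M) (hconn : IsPreconnected M) (ha : a ∈ M) (hb : b ∈ M) :
    ∃ K ⊆ M, IsIrreducibleBetween a b K := by
  obtain ⟨K, hKM, hK⟩ := zorn_superset_nonempty
    {N : Set X | IsClosed N ∧ IsPreconnected N ∧ a ∈ N ∧ b ∈ N} (by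
      intro c hc hchain hne
      refine ⟨⋂₀ c, ⟨isClosed_sInter fun N hN => (hc hN).1,
        isPreconnected_sInter_of_isChain hchain hne (fun N hN => (hc hN).1)
          fun N hN => (hc hN).2.1,
        fun N hN => (hc hN).2.2.1, fun N hN => (hc hN).2.2.2⟩,
        fun N hN => sInter_subset_of_mem hN⟩) M ⟨hM, hconn, ha, hb⟩
  refine ⟨K, hKM, hK.prop.1, hK.prop.2.1, hK.prop.2.2.1, hK.prop.2.2.2, ?_⟩
  intro N hN h1 h2 h3 h4
  exact hN.antisymm (hK.2 ⟨h1, h2, h3, h4⟩ hN)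

/-- In a closed set `S`, a component contained in an open set `O` is contained in a relatively
clopen set contained in `O`. -/
theorem exists_isClopen_of_connectedComponentIn_subset [CompactSpace X] [T2Space X]
    {S O : Set X} {x : X} (hS : IsClosed S) (hx : x ∈ S) (hO : IsOpen O)
    (h : connectedComponentIn S x ⊆ O) :
    ∃ T ⊆ S ∩ O, x ∈ T ∧ IsClosed T ∧ ∃ W, IsOpen W ∧ T = S ∩ W := by
  have : CompactSpace S := isCompact_iff_compactSpace.1 hS.isCompact
  have h' : connectedComponent (⟨x, hx⟩ : S) ⊆ Subtype.val ⁻¹' O := by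
    rw [connectedComponentIn_eq_image hx] at h
    exact image_subset_iff.1 h
  -- In a compact Hausdorff space components are quasicomponents, so compactness yields one clopen
  -- set inside `O`.
  rw [connectedComponent_eq_iInter_isClopen] at h'
  have hdir : Directed (· ⊇ ·)
      (fun s : { s : Set S // IsClopen s ∧ (⟨x, hx⟩ : S) ∈ s } => (s : Set S)) := by
    intro s t
    exact ⟨⟨s ∩ t, s.2.1.inter t.2.1, s.2.2, t.2.2⟩, inter_subset_left, inter_subset_right⟩
  have : Nonempty { s : Set S // IsClopen s ∧ (⟨x, hx⟩ : S) ∈ s } :=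
    ⟨⟨univ, isClopen_univ, trivial⟩⟩
  obtain ⟨s, hs⟩ := exists_subset_nhds_of_compactSpace hdir (fun s => s.2.1.1)
    (fun z hz => (hO.preimage continuous_subtype_val).mem_nhds (h' hz))
  obtain ⟨W, hW, hWs⟩ := isOpen_induced_iff.1 s.2.1.2
  have himg : Subtype.val '' (s : Set S) = S ∩ W := by
    rw [← hWs, Subtype.image_preimage_val]
  refine ⟨Subtype.val '' (s : Set S), ?_, ⟨_, s.2.2, rfl⟩,
    hS.isClosedEmbedding_subtypeVal.isClosedMap _ s.2.1.1, W, hW, himg⟩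
  rintro _ ⟨z, hz, rfl⟩
  exact ⟨z.2, hs hz⟩

/-- Boundary bumping for closed sets. -/
theorem connectedComponentIn_inter_frontier_nonempty [CompactSpace X] [T2Space X]
    [PreconnectedSpace X] {S : Set X} {x : X} (hS : IsClosed S) (hx : x ∈ S) (hSu : S ≠ univ) :
    (connectedComponentIn S x ∩ frontier S).Nonempty := by
  by_contra hne
  obtain ⟨T, hTS, hxT, hT, W, hW, hTW⟩ := exists_isClopen_of_connectedComponentIn_subset hS hx
    (isClosed_frontier.isOpen_compl) (fun z hz hf => hne ⟨z, hz, hf⟩)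
  -- Since `T` misses the frontier of `S`, it is open in the whole space and not just in `S`.
  have hT' : T = interior S ∩ W := by
    refine Subset.antisymm (fun z hz => ⟨?_, (hTW ▸ hz : z ∈ S ∩ W).2⟩) ?_
    · by_contra hi
      exact (hTS hz).2 ⟨subset_closure (hTS hz).1, hi⟩
    · rw [hTW]
      exact inter_subset_inter_left _ interior_subset
  have hTo : IsOpen T := hT' ▸ isOpen_interior.inter hW
  have : T = univ := IsClopen.eq_univ ⟨hT, hTo⟩ ⟨x, hxT⟩
  exact hSu (univ_subset_iff.1 fun z _ => (hTS (this ▸ mem_univ z : z ∈ T)).1)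

/-- Boundary bumping for open sets. -/
theorem closure_connectedComponentIn_compl_inter_nonempty [CompactSpace X] [T2Space X]
    [PreconnectedSpace X] {K : Set X} {y : X} (hK : IsClosed K) (hne : K.Nonempty) (hy : y ∉ K) :
    (closure (connectedComponentIn Kᶜ y) ∩ K).Nonempty := by
  by_contra hcon
  obtain ⟨O, O', hO, hO', hYO, hKO, hd⟩ := SeparatedNhds.of_isCompact_isCompact
    (isClosed_closure (s := connectedComponentIn Kᶜ y)).isCompact hK.isCompact
    (disjoint_left.2 fun z h1 h2 => hcon ⟨z, h1, h2⟩)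
  have hyY : y ∈ connectedComponentIn Kᶜ y := mem_connectedComponentIn hy
  have hyO' : y ∈ O'ᶜ := disjoint_left.1 hd (hYO (subset_closure hyY))
  obtain ⟨k, hk⟩ := hne
  -- The closed case for `O'ᶜ` gives a point of the component in the closure of `O'`, although the
  -- component lies in `O`.
  obtain ⟨z, hz1, hz2⟩ := connectedComponentIn_inter_frontier_nonempty hO'.isClosed_compl hyO'
    (fun h => (h ▸ mem_univ k : k ∈ O'ᶜ) (hKO hk))
  have hzY : z ∈ connectedComponentIn Kᶜ y :=
    connectedComponentIn_mono y (compl_subset_compl.2 hKO) hz1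
  rw [frontier_compl] at hz2
  exact disjoint_left.1 (hd.closure_right hO) (hYO (subset_closure hzY)) hz2.1

end GeneralTopology

/-! ### Arcs characterized by separating points -/

section ArcCharacterization

variable {X : Type u}

/-- A choice, for each point `p`, of a partition of the complement of `p` in two open sets
`P p` and `Q p`, with `a` and `b` on different sides. -/
structure CutSystem [TopologicalSpace X] (a b : X) (P Q : X → Set X) : Prop where
  isOpen_left : ∀ p, IsOpen (P p)
  isOpen_right : ∀ p, IsOpen (Q p)
  disjoint : ∀ p, Disjoint (P p) (Q p)
  union_eq : ∀ p, P p ∪ Q p = {p}ᶜ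
  left_mem : ∀ p, a ∈ insert p (P p)
  right_mem : ∀ p, b ∈ insert p (Q p)
  left_eq : P a = ∅
  right_eq : Q b = ∅

namespace CutSystem

section

variable [TopologicalSpace X] {a b : X} {P Q : X → Set X}

theorem symm (h : CutSystem a b P Q) : CutSystem b a Q P :=
  ⟨h.2, h.1, fun p => (h.3 p).symm, fun p => by rw [union_comm, h.4], h.6, h.5, h.8, h.7⟩

theorem notMem_left (h : CutSystem a b P Q) (p : X) : p ∉ P p := fun hp =>
  (h.union_eq p ▸ Or.inl hp : p ∈ ({p}ᶜ : Set X)) rfl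

theorem notMem_right (h : CutSystem a b P Q) (p : X) : p ∉ Q p := h.symm.notMem_left p

theorem mem_or_mem (h : CutSystem a b P Q) {x p : X} (hxp : x ≠ p) : x ∈ P p ∨ x ∈ Q p := by
  change x ∈ P p ∪ Q p
  rw [h.union_eq]
  exact hxp

theorem insert_left_eq (h : CutSystem a b P Q) (p : X) : insert p (P p) = (Q p)ᶜ := by
  ext x
  constructor
  · rintro (rfl | hx)
    · exact h.notMem_right x
    · exact disjoint_left.1 (h.disjoint p) hx
  · intro hx
    by_cases hxp : x = p
    · exact Or.inl hxp
    · exact Or.inr ((h.mem_or_mem hxp).resolve_right hx)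

theorem isClosed_insert_left (h : CutSystem a b P Q) (p : X) : IsClosed (insert p (P p)) := by
  rw [h.insert_left_eq]
  exact (h.isOpen_right p).isClosed_compl

theorem isPreconnected_insert_left [PreconnectedSpace X] (h : CutSystem a b P Q) (p : X) :
    IsPreconnected (insert p (P p)) := by
  refine isPreconnected_of_union_of_inter_subset_singleton (c := p) isPreconnected_univ
    (h.isClosed_insert_left p) (h.symm.isClosed_insert_left p) ?_ ?_ (mem_insert _ _)
  · refine (eq_univ_of_forall fun x => ?_).symm
    by_cases hxp : x = p
    · exact Or.inl (Or.inl hxp)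
    · exact (h.mem_or_mem hxp).imp Or.inr Or.inr
  · rintro x ⟨h1 | h1, h2 | h2⟩
    exacts [h1, h1, h2, (disjoint_left.1 (h.disjoint p) h1 h2).elim]

/-- Read `x ∈ P p` as "`x` precedes `p`". The connected set `insert p (Q p)` misses `x` and meets `Q
x` in `b`, so it lies in `Q x`. -/
theorem mem_right_of_mem_left [PreconnectedSpace X] (h : CutSystem a b P Q) {x p : X}
    (hx : x ∈ P p) : p ∈ Q x := by
  have hxQ : x ∉ insert p (Q p) := by
    rw [h.symm.insert_left_eq]
    exact not_not.2 hx
  have hsub : insert p (Q p) ⊆ P x ∪ Q x := by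
    rw [h.union_eq]
    intro z hz hzx
    exact hxQ (hzx ▸ hz)
  have hbx : b ≠ x := fun hbx => hxQ (hbx ▸ h.right_mem p)
  have hb : b ∈ Q x := (h.right_mem x).resolve_left hbx
  exact (h.symm.isPreconnected_insert_left p).subset_right_of_subset_union (h.isOpen_left x)
    (h.isOpen_right x) (h.disjoint x) hsub ⟨b, h.right_mem p, hb⟩ (mem_insert _ _)

theorem mem_left_iff [PreconnectedSpace X] (h : CutSystem a b P Q) {x p : X} :
    x ∈ P p ↔ p ∈ Q x :=
  ⟨h.mem_right_of_mem_left, h.symm.mem_right_of_mem_left⟩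

theorem insert_left_subset [PreconnectedSpace X] (h : CutSystem a b P Q) {x p : X}
    (hx : x ∈ P p) : insert x (P x) ⊆ P p := by
  have hp : p ∉ insert x (P x) := by
    rw [h.insert_left_eq]
    exact not_not.2 (h.mem_left_iff.1 hx)
  have hsub : insert x (P x) ⊆ P p ∪ Q p := by
    rw [h.union_eq]
    intro z hz hzp
    exact hp (hzp ▸ hz)
  exact (h.isPreconnected_insert_left x).subset_left_of_subset_union (h.isOpen_left p)
    (h.isOpen_right p) (h.disjoint p) hsub ⟨x, mem_insert _ _, hx⟩

/-- The order is dense: with nothing between `p` and `x`, the closed sets of points up to `p` and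
from `x` on would disconnect the space. -/
theorem exists_between [PreconnectedSpace X] (h : CutSystem a b P Q) {x p : X}
    (hp : p ∈ P x) : ∃ z, z ∈ P x ∧ z ∈ Q p := by
  by_contra hcon
  push Not at hcon
  obtain ⟨z, -, hz1, hz2⟩ := isPreconnected_closed_iff.1 (isPreconnected_univ (α := X))
    (insert p (P p)) (insert x (Q x)) (h.isClosed_insert_left p) (h.symm.isClosed_insert_left x)
    (fun z _ => by
      rw [h.insert_left_eq, h.symm.insert_left_eq]
      by_cases hz : z ∈ P x
      · exact Or.inl (hcon z hz)
      · exact Or.inr hz)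
    ⟨p, trivial, mem_insert _ _⟩ ⟨x, trivial, mem_insert _ _⟩
  rw [h.symm.insert_left_eq] at hz2
  exact hz2 (h.insert_left_subset hp hz1)

/-- If `p` precedes `x`, choose `z` strictly between; then every point of `P z` precedes every point
of `Q z`. -/
theorem isClosed_setOf_mem [PreconnectedSpace X] (h : CutSystem a b P Q) :
    IsClosed {q : X × X | q.1 ∈ insert q.2 (P q.2)} := by
  rw [← isOpen_compl_iff, isOpen_iff_mem_nhds]
  rintro ⟨x, p⟩ hxp
  have hxp' : x ∈ Q p := by
    rw [mem_compl_iff, mem_ofPred_eq, h.insert_left_eq] at hxp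
    exact not_not.1 hxp
  obtain ⟨z, hz1, hz2⟩ := h.exists_between (h.mem_left_iff.2 hxp')
  have : Q z ×ˢ P z ∈ 𝓝 (x, p) := prod_mem_nhds
    ((h.isOpen_right z).mem_nhds (h.mem_left_iff.1 hz1))
    ((h.isOpen_left z).mem_nhds (h.mem_left_iff.2 hz2))
  filter_upwards [this]
  rintro ⟨y, q⟩ ⟨hy, hq⟩
  rw [mem_compl_iff, mem_ofPred_eq, h.insert_left_eq, notMem_compl_iff]
  exact h.symm.insert_left_subset (h.mem_left_iff.1 hq) (Or.inr hy)

end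

variable [MetricSpace X] [CompactSpace X] [PreconnectedSpace X] {a b : X} {P Q : X → Set X}

open Metric in
-- Sublevel sets are projections of closed sets in a compact product, because the order relation is
-- closed; strict sublevel sets are open because each `Q x` is.
theorem continuous_infDist (h : CutSystem a b P Q) (d : X) :
    Continuous fun p => infDist d (insert p (P p)) := by
  have hne : ∀ p, (insert p (P p)).Nonempty := fun p => ⟨p, mem_insert _ _⟩
  refine continuous_iff_lower_upperSemicontinuous.2 ⟨?_, ?_⟩
  · rw [lowerSemicontinuous_iff_isClosed_preimage]
    intro r
    have : (fun p => infDist d (insert p (P p))) ⁻¹' Iic r =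
        Prod.snd '' ({q : X × X | q.1 ∈ insert q.2 (P q.2)} ∩ {q | dist d q.1 ≤ r}) := by
      ext p
      constructor
      · intro hp
        obtain ⟨y, hy, hyd⟩ := (h.isClosed_insert_left p).isCompact.exists_infDist_eq_dist
          (hne p) d
        exact ⟨(y, p), ⟨hy, (hyd ▸ hp : dist d y ≤ r)⟩, rfl⟩
      · rintro ⟨⟨y, p⟩, ⟨hy, hyd⟩, rfl⟩
        have hyd' : dist d y ≤ r := hyd
        have hy' : y ∈ insert p (P p) := hy
        exact (infDist_le_dist_of_mem hy').trans hyd'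
    rw [this]
    refine isClosedMap_snd_of_compactSpace _ (h.isClosed_setOf_mem.inter ?_)
    exact isClosed_le (by fun_prop) continuous_const
  · rw [upperSemicontinuous_iff_isOpen_preimage]
    intro r
    have : (fun p => infDist d (insert p (P p))) ⁻¹' Iio r =
        ball d r ∪ ⋃ x ∈ ball d r, Q x := by
      ext p
      rw [mem_preimage, mem_Iio, infDist_lt_iff (hne p)]
      simp only [mem_union, mem_iUnion, exists_prop]
      constructor
      · rintro ⟨y, rfl | hy, hyd⟩
        · exact Or.inl (mem_ball'.2 hyd)
        · exact Or.inr ⟨y, mem_ball'.2 hyd, h.mem_left_iff.1 hy⟩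
      · rintro (hp | ⟨y, hy, hyp⟩)
        · exact ⟨p, mem_insert _ _, mem_ball'.1 hp⟩
        · exact ⟨y, Or.inr (h.mem_left_iff.2 hyp), mem_ball'.1 hy⟩
    rw [this]
    exact isOpen_ball.union (isOpen_biUnion fun x _ => h.isOpen_right x)

open Metric in
-- Initial segments grow along the order, so their distances from a dense sequence decrease; minus a
-- weighted sum of these distances embeds the order in the reals.
theorem exists_strictAnti (h : CutSystem a b P Q) :
    ∃ F : X → ℝ, Continuous F ∧ ∀ x p, x ∈ P p → F x < F p := by
  have : Nonempty X := ⟨a⟩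
  set s := TopologicalSpace.denseSeq X with hs
  set C := diam (univ : Set X) with hC
  have hbd : ∀ d p, infDist d (insert p (P p)) ≤ C := fun d p =>
    (infDist_le_dist_of_mem (mem_insert p _)).trans
      (dist_le_diam_of_mem isCompact_univ.isBounded trivial trivial)
  have hnn : ∀ n p, 0 ≤ (1 / 2 : ℝ) ^ n * infDist (s n) (insert p (P p)) := fun n p =>
    mul_nonneg (by positivity) infDist_nonneg
  have hle : ∀ n p, (1 / 2 : ℝ) ^ n * infDist (s n) (insert p (P p)) ≤ (1 / 2 : ℝ) ^ n * C :=
    fun n p => mul_le_mul_of_nonneg_left (hbd _ _) (by positivity)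
  have hsumC : Summable fun n : ℕ => (1 / 2 : ℝ) ^ n * C := summable_geometric_two.mul_right C
  have hsum : ∀ p, Summable fun n => (1 / 2 : ℝ) ^ n * infDist (s n) (insert p (P p)) :=
    fun p => Summable.of_nonneg_of_le (fun n => hnn n p) (fun n => hle n p) hsumC
  refine ⟨fun p => -∑' n, (1 / 2 : ℝ) ^ n * infDist (s n) (insert p (P p)), ?_, ?_⟩
  · refine (continuous_tsum (fun n => continuous_const.mul (h.continuous_infDist (s n)))
      hsumC fun n p => ?_).neg
    exact (Real.norm_of_nonneg (hnn n p)).trans_le (hle n p)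
  · intro x p hxp
    have hpos : 0 < infDist p (insert x (P x)) := by
      rw [← (h.isClosed_insert_left x).notMem_iff_infDist_pos ⟨x, mem_insert _ _⟩,
        h.insert_left_eq, notMem_compl_iff]
      exact h.mem_left_iff.1 hxp
    -- A dense point within half the distance from `p` to the segment of `x` is closer to `p` than
    -- to that segment, which makes one term strict.
    obtain ⟨n, hn⟩ := (TopologicalSpace.denseRange_denseSeq X).exists_dist_lt p (half_pos hpos)
    have hsub : insert x (P x) ⊆ insert p (P p) :=
      (h.insert_left_subset hxp).trans (subset_insert _ _)
    refine neg_lt_neg ((hsum p).tsum_lt_tsum (i := n) (fun m => ?_) ?_ (hsum x))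
    · exact mul_le_mul_of_nonneg_left (infDist_le_infDist_of_subset hsub ⟨x, mem_insert _ _⟩)
        (by positivity)
    · refine mul_lt_mul_of_pos_left ?_ (by positivity)
      have h1 : infDist (s n) (insert p (P p)) ≤ dist (s n) p :=
        infDist_le_dist_of_mem (mem_insert _ _)
      have h2 : infDist p (insert x (P x)) ≤ infDist (s n) (insert x (P x)) + dist p (s n) :=
        infDist_le_infDist_add_dist
      rw [dist_comm] at h1
      linarith

/-- A nondegenerate metric continuum with a cut system between `a` and `b` is an arc from `a`
to `b`. -/
theorem exists_homeomorph (h : CutSystem a b P Q) (hab : a ≠ b) :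
    ∃ e : I ≃ₜ X, e 0 = a ∧ e 1 = b := by
  obtain ⟨F, hF, hlt⟩ := h.exists_strictAnti
  have hinj : Function.Injective F := by
    intro x p hxp
    by_contra hne
    rcases h.mem_or_mem hne with h1 | h1
    · exact (hlt _ _ h1).ne hxp
    · exact (hlt _ _ (h.mem_left_iff.2 h1)).ne' hxp
  have ha : ∀ x, F a ≤ F x := fun x =>
    (h.left_mem x).elim (fun h1 => h1 ▸ le_rfl) fun h1 => (hlt _ _ h1).le
  have hb : ∀ x, F x ≤ F b := fun x =>
    (h.right_mem x).elim (fun h1 => h1 ▸ le_rfl) fun h1 => (hlt _ _ (h.mem_left_iff.2 h1)).le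
  have hFab : F a < F b := (ha b).lt_of_ne fun h1 => hab (hinj h1)
  have hrange : range F = Icc (F a) (F b) := by
    refine Subset.antisymm ?_ ?_
    · rintro _ ⟨x, rfl⟩
      exact ⟨ha x, hb x⟩
    · exact (isPreconnected_range hF).Icc_subset ⟨a, rfl⟩ ⟨b, rfl⟩
  let e : X ≃ₜ I := ((hF.isClosedEmbedding hinj).isEmbedding.toHomeomorph.trans
    (Homeomorph.setCongr hrange)).trans (iccHomeoI (F a) (F b) hFab)
  refine ⟨e.symm, ?_, ?_⟩
  · rw [Homeomorph.symm_apply_eq]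
    refine Subtype.ext ?_
    change (0 : ℝ) = (F a - F a) / (F b - F a)
    simp
  · rw [Homeomorph.symm_apply_eq]
    refine Subtype.ext ?_
    change (1 : ℝ) = (F b - F a) / (F b - F a)
    rw [div_self (sub_pos.2 hFab).ne']

end CutSystem

/-- If each point other than `a` and `b` separates `a` from `b` in a nondegenerate metric
continuum, then the continuum is an arc from `a` to `b`. -/
theorem exists_homeomorph_of_separating [MetricSpace X] [CompactSpace X] [PreconnectedSpace X]
    {a b : X} (hab : a ≠ b)
    (h : ∀ p, p ≠ a → p ≠ b → ∃ P Q : Set X, IsOpen P ∧ IsOpen Q ∧ Disjoint P Q ∧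
      P ∪ Q = {p}ᶜ ∧ a ∈ P ∧ b ∈ Q) :
    ∃ e : I ≃ₜ X, e 0 = a ∧ e 1 = b := by
  have h' : ∀ p, ∃ PQ : Set X × Set X, IsOpen PQ.1 ∧ IsOpen PQ.2 ∧ Disjoint PQ.1 PQ.2 ∧
      PQ.1 ∪ PQ.2 = {p}ᶜ ∧ a ∈ insert p PQ.1 ∧ b ∈ insert p PQ.2 ∧ (p = a → PQ.1 = ∅) ∧
      (p = b → PQ.2 = ∅) := by
    intro p
    by_cases hpa : p = a
    · subst hpa
      exact ⟨(∅, {p}ᶜ), isOpen_empty, isOpen_compl_singleton, empty_disjoint _, empty_union _,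
        Or.inl rfl, Or.inr hab.symm, fun _ => rfl, fun hb => (hab hb).elim⟩
    by_cases hpb : p = b
    · subst hpb
      exact ⟨({p}ᶜ, ∅), isOpen_compl_singleton, isOpen_empty, disjoint_empty _, union_empty _,
        Or.inr hab, Or.inl rfl, fun ha => (hab ha.symm).elim, fun _ => rfl⟩
    obtain ⟨P, Q, h1, h2, h3, h4, h5, h6⟩ := h p hpa hpb
    exact ⟨(P, Q), h1, h2, h3, h4, Or.inr h5, Or.inr h6, fun ha => (hpa ha).elim,
      fun hb => (hpb hb).elim⟩
  choose PQ h1 h2 h3 h4 h5 h6 h7 h8 using h'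
  exact CutSystem.exists_homeomorph (P := fun p => (PQ p).1) (Q := fun p => (PQ p).2)
    ⟨h1, h2, h3, h4, h5, h6, h7 a rfl, h8 b rfl⟩ hab

end ArcCharacterization

/-! ### Irreducible continua through points of order at most two -/

section Irreducible

variable {X : Type u} [TopologicalSpace X]

/-- By irreducibility `K \ D` is not connected. In any closed splitting each piece meets `frontier
D`, since otherwise it would split off from `K`. With at most two boundary points, each piece gets
exactly one, meets the rest of `K` only there, and is therefore connected. Irreducibility again puts
`a` and `b` into different pieces. -/
theorem IsIrreducibleBetween.exists_partition {a b q : X} {K D : Set X}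
    (hK : IsIrreducibleBetween a b K) (hD : IsOpen D) (haD : a ∉ D) (hbD : b ∉ D) (hqK : q ∈ K)
    (hqD : q ∈ D) (hcard : (frontier D).encard ≤ 2) :
    ∃ A B : Set X, IsClosed A ∧ IsClosed B ∧ IsPreconnected A ∧ IsPreconnected B ∧
      A ∪ B = K \ D ∧ a ∈ A ∧ b ∈ B ∧ frontier D ⊆ K := by
  have hKD : IsClosed (K \ D) := hK.isClosed.sdiff hD
  have hproper : ∀ M ⊆ K \ D, IsClosed M → IsPreconnected M → a ∈ M → b ∈ M → False :=
    fun M hM h1 h2 h3 h4 =>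
      (hM ((hK.eq_of_subset M (hM.trans sdiff_subset) h1 h2 h3 h4).symm ▸ hqK : q ∈ M)).2 hqD
  have hunion : ∀ T T' : Set X, T ∪ T' = K \ D → K = T ∪ (T' ∪ K ∩ closure D) := by
    intro T T' h
    rw [← union_assoc, h]
    ext z
    by_cases hz : z ∈ D
    · simp [hz, subset_closure hz]
    · simp only [mem_union, mem_sdiff, hz, mem_inter_iff]
      tauto
  have hfr : ∀ T T' : Set X, T ∪ T' = K \ D → Disjoint T T' →
      T ∩ (T' ∪ K ∩ closure D) ⊆ T ∩ frontier D := by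
    rintro T T' h hd z ⟨hz, hz' | hz'⟩
    · exact (disjoint_left.1 hd hz hz').elim
    · refine ⟨hz, hz'.2, ?_⟩
      rw [hD.interior_eq]
      exact (h ▸ Or.inl hz : z ∈ K \ D).2
  have hmeet : ∀ T T' : Set X, IsClosed T → IsClosed T' → T ∪ T' = K \ D → Disjoint T T' →
      T.Nonempty → (T ∩ frontier D).Nonempty := by
    intro T T' hT hT' h hd ⟨t, ht⟩
    obtain ⟨z, -, hz⟩ := isPreconnected_closed_iff.1 hK.isPreconnected T (T' ∪ K ∩ closure D) hT
      (hT'.union (hK.isClosed.inter isClosed_closure)) (hunion T T' h).subset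
      ⟨t, (h ▸ Or.inl ht : t ∈ K \ D).1, ht⟩ ⟨q, hqK, Or.inr ⟨hqK, subset_closure hqD⟩⟩
    exact ⟨z, hfr T T' h hd hz⟩
  have hconn : ∀ T T' : Set X, ∀ c d : X, IsClosed T → IsClosed T' → T ∪ T' = K \ D →
      Disjoint T T' → frontier D ⊆ {c, d} → c ∈ T → d ∈ T' → IsPreconnected T := by
    intro T T' c d hT hT' h hd hcd hc hd'
    refine isPreconnected_of_union_of_inter_subset_singleton hK.isPreconnected hT
      (hT'.union (hK.isClosed.inter isClosed_closure)) (hunion T T' h) ?_ hc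
    intro z hz
    obtain ⟨hzT, hzf⟩ := hfr T T' h hd hz
    rcases hcd hzf with h1 | h1
    · exact h1
    · exact (disjoint_left.1 hd hzT (h1 ▸ hd')).elim
  have hnot : ¬ IsPreconnected (K \ D) := fun h =>
    hproper _ Subset.rfl hKD h ⟨hK.left_mem, haD⟩ ⟨hK.right_mem, hbD⟩
  rw [isPreconnected_iff_subset_of_fully_disjoint_closed hKD] at hnot
  push Not at hnot
  obtain ⟨u, v, hu, hv, huv, hduv, hnu, hnv⟩ := hnot
  have hT : IsClosed (K \ D ∩ u) := hKD.inter hu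
  have hT' : IsClosed (K \ D ∩ v) := hKD.inter hv
  have hTT : (K \ D ∩ u) ∪ (K \ D ∩ v) = K \ D := by
    rw [← inter_union_distrib_left, inter_eq_left.2 huv]
  have hTT' : (K \ D ∩ v) ∪ (K \ D ∩ u) = K \ D := by rw [union_comm, hTT]
  have hd : Disjoint (K \ D ∩ u) (K \ D ∩ v) :=
    hduv.mono inter_subset_right inter_subset_right
  obtain ⟨t, ht, htv⟩ := not_subset.1 hnv
  obtain ⟨t', ht', htu⟩ := not_subset.1 hnu
  obtain ⟨c, hcT, hcf⟩ := hmeet _ _ hT hT' hTT hd ⟨t, ht, (huv ht).resolve_right htv⟩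
  obtain ⟨d, hdT, hdf⟩ := hmeet _ _ hT' hT hTT' hd.symm ⟨t', ht', (huv ht').resolve_left htu⟩
  have hcd : c ≠ d := fun h => disjoint_left.1 hd hcT (h ▸ hdT)
  have hfeq : ({c, d} : Set X) = frontier D :=
    Finite.eq_of_subset_of_encard_le (toFinite _) (insert_subset hcf (singleton_subset_iff.2 hdf))
      (by rwa [encard_pair hcd])
  have hTc := hconn _ _ c d hT hT' hTT hd hfeq.symm.subset hcT hdT
  have hTc' := hconn _ _ d c hT' hT hTT' hd.symm (by rw [pair_comm, hfeq]) hdT hcT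
  have hfK : frontier D ⊆ K := by
    rw [← hfeq]
    rintro z (rfl | rfl)
    exacts [hcT.1.1, hdT.1.1]
  have ha : a ∈ (K \ D ∩ u) ∪ (K \ D ∩ v) := hTT.superset ⟨hK.left_mem, haD⟩
  have hb : b ∈ (K \ D ∩ u) ∪ (K \ D ∩ v) := hTT.superset ⟨hK.right_mem, hbD⟩
  rcases ha with ha | ha <;> rcases hb with hb | hb
  · exact (hproper _ inter_subset_left hT hTc ha hb).elim
  · exact ⟨_, _, hT, hT', hTc, hTc', hTT, ha, hb, hfK⟩
  · exact ⟨_, _, hT', hT, hTc', hTc, hTT', ha, hb, hfK⟩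
  · exact (hproper _ inter_subset_left hT' hTc' ha hb).elim

/-- Each neighborhood of `x` contains an open neighborhood with at most `n` boundary points. -/
def HasSmallBoundaries (n : ℕ∞) (x : X) : Prop :=
  ∀ U : Set X, IsOpen U → x ∈ U → ∃ V : Set X, IsOpen V ∧ x ∈ V ∧ V ⊆ U ∧
    (frontier V).encard ≤ n

theorem HasSmallBoundaries.exists_closure_subset [RegularSpace X] {n : ℕ∞} {x : X}
    (h : HasSmallBoundaries n x) {O : Set X} (hO : IsOpen O) (hx : x ∈ O) :
    ∃ V : Set X, IsOpen V ∧ x ∈ V ∧ closure V ⊆ O ∧ (frontier V).encard ≤ n := by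
  obtain ⟨F, hF, hFc, hFO⟩ := exists_mem_nhds_isClosed_subset (hO.mem_nhds hx)
  obtain ⟨V, hV, hxV, hVF, hcard⟩ := h (interior F) isOpen_interior
    (mem_interior_iff_mem_nhds.2 hF)
  exact ⟨V, hV, hxV, (closure_minimal (hVF.trans interior_subset) hFc).trans hFO, hcard⟩

/-- The points of `K` that can be joined with `a` in `K` by a continuum missing `p`. -/
def joinedAvoiding (K : Set X) (p a : X) : Set K :=
  {z | ∃ M ⊆ K, IsClosed M ∧ IsPreconnected M ∧ a ∈ M ∧ (z : X) ∈ M ∧ p ∉ M}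

/-- `M ∪ N` would be a continuum in `K` joining `a` to `b` and missing `p`. -/
theorem IsIrreducibleBetween.false_of_joined {a b p z : X} {K M N : Set X}
    (hK : IsIrreducibleBetween a b K) (hp : p ∈ K) (hMK : M ⊆ K) (hM : IsClosed M)
    (hMc : IsPreconnected M) (haM : a ∈ M) (hzM : z ∈ M) (hpM : p ∉ M)
    (hNK : N ⊆ K) (hN : IsClosed N) (hNc : IsPreconnected N) (hbN : b ∈ N) (hzN : z ∈ N)
    (hpN : p ∉ N) : False := by
  have := hK.eq_of_subset (M ∪ N) (union_subset hMK hNK) (hM.union hN)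
    (hMc.union z hzM hzN hNc) (Or.inl haM) (Or.inr hbN)
  rcases (this ▸ hp : p ∈ M ∪ N) with h | h
  exacts [hpM h, hpN h]

theorem IsIrreducibleBetween.disjoint_joinedAvoiding {a b p : X} {K : Set X}
    (hK : IsIrreducibleBetween a b K) (hp : p ∈ K) :
    Disjoint (joinedAvoiding K p a) (joinedAvoiding K p b) := by
  rw [disjoint_left]
  rintro z ⟨M, hMK, hM, hMc, haM, hzM, hpM⟩ ⟨N, hNK, hN, hNc, hbN, hzN, hpN⟩
  exact hK.false_of_joined hp hMK hM hMc haM hzM hpM hNK hN hNc hbN hzN hpN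

variable [T2Space X] [RegularSpace X]

theorem IsIrreducibleBetween.exists_partition_avoiding {a b p : X} {K : Set X}
    (hK : IsIrreducibleBetween a b K) (hpK : p ∈ K) (hpa : p ≠ a) (hpb : p ≠ b)
    (hp : HasSmallBoundaries 2 p) {z : X} (hzp : z ≠ p) :
    ∃ A B D : Set X, IsOpen D ∧ p ∈ D ∧ z ∉ closure D ∧ IsClosed A ∧ IsClosed B ∧
      IsPreconnected A ∧ IsPreconnected B ∧ A ∪ B = K \ D ∧ a ∈ A ∧ b ∈ B := by
  obtain ⟨D, hD, hpD, hDO, hcard⟩ := hp.exists_closure_subset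
    (O := ({a, b, z} : Set X)ᶜ) (toFinite _).isClosed.isOpen_compl
    (by
      rintro (h | h | h)
      exacts [hpa h, hpb h, hzp h.symm])
  have hmem : ∀ w ∈ ({a, b, z} : Set X), w ∉ closure D := fun w hw h => hDO h hw
  obtain ⟨A, B, hA, hB, hAc, hBc, hAB, haA, hbB, -⟩ := hK.exists_partition hD
    (fun h => hmem a (by simp) (subset_closure h)) (fun h => hmem b (by simp) (subset_closure h))
    hpK hpD hcard
  exact ⟨A, B, D, hD, hpD, hmem z (by simp), hA, hB, hAc, hBc, hAB, haA, hbB⟩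

/-- For a small `D` around `p`, the point `z` is not in the piece `B`, which would join it to `b`.
So all points of `K` near `z` lie in the piece `A`, which joins them to `a`. -/
theorem IsIrreducibleBetween.isOpen_joinedAvoiding {a b p : X} {K : Set X}
    (hK : IsIrreducibleBetween a b K) (hpK : p ∈ K) (hpa : p ≠ a) (hpb : p ≠ b)
    (hp : HasSmallBoundaries 2 p) : IsOpen (joinedAvoiding K p a) := by
  rw [isOpen_iff_mem_nhds]
  rintro z ⟨M, hMK, hM, hMc, haM, hzM, hpM⟩
  obtain ⟨A, B, D, hD, hpD, hzD, hA, hB, hAc, hBc, hAB, haA, hbB⟩ :=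
    hK.exists_partition_avoiding hpK hpa hpb hp (z := z) fun h => hpM (h ▸ hzM)
  have hAK : A ⊆ K \ D := hAB ▸ subset_union_left
  have hBK : B ⊆ K \ D := hAB ▸ subset_union_right
  have hzB : (z : X) ∉ B := fun hzB =>
    hK.false_of_joined hpK hMK hM hMc haM hzM hpM (hBK.trans sdiff_subset) hB hBc hbB hzB
      fun h => (hBK h).2 hpD
  have hO : IsOpen (B ∪ closure D)ᶜ := (hB.union isClosed_closure).isOpen_compl
  filter_upwards [(hO.preimage continuous_subtype_val).mem_nhds
    (show (z : X) ∈ (B ∪ closure D)ᶜ from fun h => h.elim hzB hzD)] with w hw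
  have hw' : (w : X) ∉ B ∪ closure D := hw
  have hwA : (w : X) ∈ A ∪ B := hAB ▸ ⟨w.2, fun h => hw' (Or.inr (subset_closure h))⟩
  exact ⟨A, hAK.trans sdiff_subset, hA, hAc, haA, hwA.resolve_right fun h => hw' (Or.inl h),
    fun h => (hAK h).2 hpD⟩

theorem IsIrreducibleBetween.exists_separation {a b : X} {K : Set X}
    (hK : IsIrreducibleBetween a b K) {p : K} (hpa : (p : X) ≠ a) (hpb : (p : X) ≠ b)
    (hp : HasSmallBoundaries 2 (p : X)) :
    ∃ P Q : Set K, IsOpen P ∧ IsOpen Q ∧ Disjoint P Q ∧ P ∪ Q = {p}ᶜ ∧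
      (⟨a, hK.left_mem⟩ : K) ∈ P ∧ (⟨b, hK.right_mem⟩ : K) ∈ Q := by
  refine ⟨joinedAvoiding K p a, joinedAvoiding K p b,
    hK.isOpen_joinedAvoiding p.2 hpa hpb hp, hK.symm.isOpen_joinedAvoiding p.2 hpb hpa hp,
    hK.disjoint_joinedAvoiding p.2, ?_, ?_, ?_⟩
  · ext z
    constructor
    · rintro (⟨M, -, -, -, -, hzM, hpM⟩ | ⟨M, -, -, -, -, hzM, hpM⟩)
      all_goals exact fun h => hpM (h ▸ hzM)
    · intro hz
      obtain ⟨A, B, D, hD, hpD, hzD, hA, hB, hAc, hBc, hAB, haA, hbB⟩ :=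
        hK.exists_partition_avoiding p.2 hpa hpb hp (z := z) fun h => hz (Subtype.ext h)
      have hAK : A ⊆ K \ D := hAB ▸ subset_union_left
      have hBK : B ⊆ K \ D := hAB ▸ subset_union_right
      have hzAB : (z : X) ∈ A ∪ B := hAB ▸ ⟨z.2, fun h => hzD (subset_closure h)⟩
      rcases hzAB with h | h
      · exact Or.inl ⟨A, hAK.trans sdiff_subset, hA, hAc, haA, h, fun h => (hAK h).2 hpD⟩
      · exact Or.inr ⟨B, hBK.trans sdiff_subset, hB, hBc, hbB, h, fun h => (hBK h).2 hpD⟩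
  · exact ⟨{a}, singleton_subset_iff.2 hK.left_mem, isClosed_singleton, isPreconnected_singleton,
      rfl, rfl, hpa⟩
  · exact ⟨{b}, singleton_subset_iff.2 hK.right_mem, isClosed_singleton, isPreconnected_singleton,
      rfl, rfl, hpb⟩

/-- A component of `Kᶜ` accumulating at `q` would enter and leave `D`, hence cross `frontier D`,
which lies in `K`. -/
theorem IsIrreducibleBetween.notMem_closure_component {a b q y : X} {K : Set X}
    (hK : IsIrreducibleBetween a b K) (hqK : q ∈ K) (hqa : q ≠ a) (hqb : q ≠ b)
    (hq : HasSmallBoundaries 2 q) (hy : y ∉ K) : q ∉ closure (connectedComponentIn Kᶜ y) := by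
  intro hcl
  obtain ⟨D, hD, hqD, hDO, hcard⟩ := hq.exists_closure_subset
    (O := ({a, b, y} : Set X)ᶜ) (toFinite _).isClosed.isOpen_compl
    (by
      rintro (h | h | h)
      exacts [hqa h, hqb h, hy (h ▸ hqK)])
  have hmem : ∀ w ∈ ({a, b, y} : Set X), w ∉ D := fun w hw h => hDO (subset_closure h) hw
  obtain ⟨-, -, -, -, -, -, -, -, -, hfK⟩ := hK.exists_partition hD (hmem a (by simp))
    (hmem b (by simp)) hqK hqD hcard
  obtain ⟨w, hwD, hwY⟩ := mem_closure_iff.1 hcl D hD hqD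
  obtain ⟨z, hzY, hzf⟩ := inter_frontier_nonempty_of_isPreconnected
    (isPreconnected_connectedComponentIn (F := Kᶜ) (x := y)) ⟨w, hwY, hwD⟩
    ⟨y, mem_connectedComponentIn hy, hmem y (by simp)⟩
  exact connectedComponentIn_subset _ _ hzY (hfK hzf)

variable [CompactSpace X]

theorem IsIrreducibleBetween.exists_param [TopologicalSpace.MetrizableSpace X] {a b : X}
    {K : Set X} (hK : IsIrreducibleBetween a b K) (hab : a ≠ b)
    (h2 : ∀ x ∈ K, HasSmallBoundaries 2 x) :
    ∃ g : I → X, Continuous g ∧ Function.Injective g ∧ range g = K ∧ g 0 = a ∧ g 1 = b := by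
  let _ : MetricSpace K := TopologicalSpace.metrizableSpaceMetric K
  have : CompactSpace K := isCompact_iff_compactSpace.1 hK.isClosed.isCompact
  have : PreconnectedSpace K := isPreconnected_iff_preconnectedSpace.1 hK.isPreconnected
  obtain ⟨e, he0, he1⟩ := exists_homeomorph_of_separating
    (a := (⟨a, hK.left_mem⟩ : K)) (b := ⟨b, hK.right_mem⟩) (fun h => hab (congrArg Subtype.val h))
    fun p hpa hpb => hK.exists_separation (fun h => hpa (Subtype.ext h))
      (fun h => hpb (Subtype.ext h)) (h2 p p.2)
  refine ⟨fun t => e t, continuous_subtype_val.comp e.continuous,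
    Subtype.val_injective.comp e.injective, ?_, ?_, ?_⟩
  · change range (Subtype.val ∘ e) = K
    rw [e.surjective.range_comp, Subtype.range_val]
  · exact congrArg Subtype.val he0
  · exact congrArg Subtype.val he1

theorem IsIrreducibleBetween.isOpen_diff [PreconnectedSpace X] {a b : X} {K : Set X}
    (hK : IsIrreducibleBetween a b K) (h2 : ∀ x ∈ K, HasSmallBoundaries 2 x) :
    IsOpen (K \ {a, b}) := by
  rw [isOpen_iff_mem_nhds]
  rintro q ⟨hqK, hqab⟩
  obtain ⟨D, hD, hqD, hDO, hcard⟩ := (h2 q hqK).exists_closure_subset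
    (O := ({a, b} : Set X)ᶜ) (toFinite _).isClosed.isOpen_compl hqab
  have hmem : ∀ w ∈ ({a, b} : Set X), w ∉ D := fun w hw h => hDO (subset_closure h) hw
  obtain ⟨-, -, -, -, -, -, -, -, -, hfK⟩ := hK.exists_partition hD (hmem a (by simp))
    (hmem b (by simp)) hqK hqD hcard
  refine Filter.mem_of_superset (hD.mem_nhds hqD) fun y hy => ⟨?_, fun h => hmem y h hy⟩
  by_contra hyK
  -- The component of `y` cannot cross `frontier D ⊆ K`. Its closure, which must touch `K`, then
  -- does so away from `a` and `b`, which is impossible.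
  have hYD : connectedComponentIn Kᶜ y ⊆ D := by
    by_contra hcon
    obtain ⟨w, hw, hwD⟩ := not_subset.1 hcon
    obtain ⟨z, hzY, hzf⟩ := inter_frontier_nonempty_of_isPreconnected
      (isPreconnected_connectedComponentIn (F := Kᶜ) (x := y))
      ⟨y, mem_connectedComponentIn hyK, hy⟩ ⟨w, hw, hwD⟩
    exact connectedComponentIn_subset _ _ hzY (hfK hzf)
  obtain ⟨z, hzY, hzK⟩ := closure_connectedComponentIn_compl_inter_nonempty hK.isClosed
    ⟨q, hqK⟩ hyK
  have hz : z ∉ ({a, b} : Set X) := hDO (closure_mono hYD hzY)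
  exact hK.notMem_closure_component hzK (fun h => hz (Or.inl h)) (fun h => hz (Or.inr h))
    (h2 z hzK) hyK hzY

end Irreducible

/-! ### Order expressed by finite boundaries -/

section Order

variable {X : Type u} [TopologicalSpace X]

theorem ord_le_natCast_iff (x : X) (n : ℕ) : ord x ≤ n ↔ HasSmallBoundaries n x := by
  have h : ∀ S : Set X, Cardinal.mk S ≤ n ↔ S.encard ≤ n := fun S =>
    Cardinal.toENat_le_natCast.symm
  simp only [ord_le_iff, h, HasSmallBoundaries]

theorem mem_endpoints_iff (x : X) :
    x ∈ endpoints X ↔ HasSmallBoundaries 1 x ∧ ¬ HasSmallBoundaries 0 x := by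
  have h1 := ord_le_natCast_iff x 1
  have h0 := ord_le_natCast_iff x 0
  rw [Nat.cast_one, Nat.cast_one] at h1
  rw [Nat.cast_zero, Nat.cast_zero, nonpos_iff_eq_zero] at h0
  rw [← h1, ← h0, ← ne_eq, ← Cardinal.one_le_iff_ne_zero]
  exact le_antisymm_iff

theorem mem_branchpoints_iff (x : X) : x ∈ branchpoints X ↔ ¬ HasSmallBoundaries 2 x := by
  have h2 := ord_le_natCast_iff x 2
  have h3 : (3 : Cardinal) ≤ ord x ↔ ¬ ord x ≤ 2 := by
    rw [not_le, ← Order.succ_le_iff]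
    have := Cardinal.succ_natCast 2
    norm_num at this
    rw [this]
  exact h3.trans (not_congr h2)

theorem not_hasSmallBoundaries_zero [PreconnectedSpace X] [T1Space X] [Nontrivial X] (x : X) :
    ¬ HasSmallBoundaries 0 x := by
  intro h
  obtain ⟨y, hy⟩ := exists_ne x
  obtain ⟨V, hV, hxV, hVy, hcard⟩ := h {y}ᶜ isOpen_compl_singleton hy.symm
  rw [nonpos_iff_eq_zero, encard_eq_zero, frontier_eq_empty_iff] at hcard
  rcases hcard with rfl | rfl
  · exact hxV
  · exact hVy (mem_univ y) rfl

end Order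

/-! ### Arcs, their endpoints and free arcs -/

section Arcs

variable {X : Type u} [TopologicalSpace X] {g : I → X}

theorem isOpen_image_of_subset [T2Space X] (hg : Continuous g) (hinj : Function.Injective g) {S O : Set I}
    (hS : IsOpen (g '' S)) (hO : IsOpen O) (hOS : O ⊆ S) : IsOpen (g '' O) := by
  obtain ⟨W, hW, rfl⟩ := (hg.isClosedEmbedding hinj).isInducing.isOpen_iff.1 hO
  have : g '' (g ⁻¹' W) = g '' S ∩ W := by
    rw [← image_inter_preimage, inter_eq_right.2 hOS]
  rw [this]
  exact hS.inter hW

theorem frontier_image_Ioo_subset [T2Space X] (hg : Continuous g) {s r : I} (ho : IsOpen (g '' Ioo s r)) :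
    frontier (g '' Ioo s r) ⊆ {g s, g r} := by
  rw [frontier, ho.interior_eq]
  rintro z ⟨hz, hz'⟩
  obtain ⟨t, ht, rfl⟩ := closure_minimal (image_mono Ioo_subset_Icc_self)
    (isCompact_Icc.image hg).isClosed hz
  rcases ht.1.eq_or_lt with h1 | h1
  · exact Or.inl (congrArg g h1.symm)
  rcases ht.2.eq_or_lt with h2 | h2
  · exact Or.inr (congrArg g h2)
  · exact (hz' ⟨t, ⟨h1, h2⟩, rfl⟩).elim

theorem hasSmallBoundaries_two_of_mem_Ioo [T2Space X] (hg : Continuous g) (hinj : Function.Injective g)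
    (ho : IsOpen (g '' Ioo 0 1)) {t : I} (ht : t ∈ Ioo (0 : I) 1) :
    HasSmallBoundaries 2 (g t) := by
  intro U hU htU
  obtain ⟨s, r, htsr, hsr⟩ := (mem_nhds_iff_exists_Ioo_subset' ⟨0, ht.1⟩ ⟨1, ht.2⟩).1
    ((hU.preimage hg).mem_nhds htU)
  have ho' : IsOpen (g '' Ioo s r) := isOpen_image_of_subset hg hinj ho isOpen_Ioo
    (Ioo_subset_Ioo s.2.1 r.2.2)
  refine ⟨g '' Ioo s r, ho', mem_image_of_mem g htsr, image_subset_iff.2 hsr, ?_⟩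
  exact (encard_le_encard (frontier_image_Ioo_subset hg ho')).trans ((encard_insert_le _ _).trans_eq (by rw [encard_singleton]; rfl))

/-- A neighborhood inside the open arc misses both ends, so it has a boundary point on either side
of `t`; these could coincide only at `g t`, which is interior. -/
theorem not_hasSmallBoundaries_one_of_mem_Ioo (hg : Continuous g) (hinj : Function.Injective g)
    (ho : IsOpen (g '' Ioo 0 1)) {t : I} (ht : t ∈ Ioo (0 : I) 1) :
    ¬ HasSmallBoundaries 1 (g t) := by
  intro h
  obtain ⟨V, hV, htV, hVo, hcard⟩ := h _ ho (mem_image_of_mem g ht)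
  have h0 : g 0 ∉ V := fun h0 => by
    obtain ⟨r, hr, hr0⟩ := hVo h0
    exact hr.1.ne (hinj hr0).symm
  have h1 : g 1 ∉ V := fun h1 => by
    obtain ⟨r, hr, hr1⟩ := hVo h1
    exact hr.2.ne (hinj hr1)
  obtain ⟨-, ⟨s, hs, rfl⟩, hsf⟩ := inter_frontier_nonempty_of_isPreconnected
    (isPreconnected_Icc.image g hg.continuousOn) ⟨g t, mem_image_of_mem g ⟨ht.1.le, le_rfl⟩, htV⟩
    ⟨g 0, mem_image_of_mem g ⟨le_rfl, ht.1.le⟩, h0⟩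
  obtain ⟨-, ⟨r, hr, rfl⟩, hrf⟩ := inter_frontier_nonempty_of_isPreconnected
    (isPreconnected_Icc.image g hg.continuousOn) ⟨g t, mem_image_of_mem g ⟨le_rfl, ht.2.le⟩, htV⟩
    ⟨g 1, mem_image_of_mem g ⟨ht.2.le, le_rfl⟩, h1⟩
  have hrs : g s = g r := encard_le_one_iff.1 hcard _ _ hsf hrf
  have hst : s = t := le_antisymm hs.2 (hinj hrs ▸ hr.1)
  rw [hV.frontier_eq] at hsf
  exact hsf.2 (hst ▸ htV)

theorem hasSmallBoundaries_one_of_isOpen_image_Iio [T2Space X] (hg : Continuous g)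
    (hinj : Function.Injective g) (ho : IsOpen (g '' Iio 1)) : HasSmallBoundaries 1 (g 0) := by
  intro U hU h0U
  obtain ⟨r, hr, hrU⟩ := (nhds_bot_basis (α := I)).mem_iff.1 ((hU.preimage hg).mem_nhds h0U)
  have ho' : IsOpen (g '' Iio r) := isOpen_image_of_subset hg hinj ho isOpen_Iio
    (Iio_subset_Iio r.2.2)
  refine ⟨g '' Iio r, ho', mem_image_of_mem g hr, image_subset_iff.2 hrU, ?_⟩
  rw [encard_le_one_iff_subsingleton]
  refine (subsingleton_singleton (a := g r)).anti ?_
  rw [ho'.frontier_eq]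
  rintro z ⟨hz, hz'⟩
  obtain ⟨t, ht, rfl⟩ := closure_minimal (image_mono Iio_subset_Iic_self)
    (isClosed_Iic.isCompact.image hg).isClosed hz
  rcases (mem_Iic.1 ht).eq_or_lt with h1 | h1
  · exact congrArg g h1
  · exact (hz' ⟨t, h1, rfl⟩).elim

theorem image_comp_symm_Iio {X : Type u} (g : I → X) : (g ∘ σ) '' Iio 1 = g '' Ioi 0 := by
  rw [image_comp]
  congr 1
  ext t
  constructor
  · rintro ⟨s, hs, rfl⟩
    exact unitInterval.pos_iff_ne_zero.2 fun h => hs.ne (by simpa using congrArg σ h)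
  · intro ht
    refine ⟨σ t, unitInterval.lt_one_iff_ne_one.2 fun h => ?_, symm_symm t⟩
    exact ht.ne' (by simpa using congrArg σ h)

theorem hasSmallBoundaries_one_of_isOpen_image_Ioi [T2Space X] (hg : Continuous g)
    (hinj : Function.Injective g) (ho : IsOpen (g '' Ioi 0)) : HasSmallBoundaries 1 (g 1) := by
  have := hasSmallBoundaries_one_of_isOpen_image_Iio (hg.comp continuous_symm)
    (hinj.comp symm_involutive.injective) (by rwa [image_comp_symm_Iio])
  simpa using this

theorem endpoints_eq_pair {K : Type u} [TopologicalSpace K] (e : I ≃ₜ K) :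
    endpoints K = {e 0, e 1} := by
  have : T2Space K := e.t2Space
  have : Nontrivial K := e.injective.nontrivial
  have : ConnectedSpace K := e.surjective.connectedSpace e.continuous
  ext x
  rw [mem_endpoints_iff]
  constructor
  · rintro ⟨h1, -⟩
    obtain ⟨t, rfl⟩ := e.surjective x
    by_contra hne
    have ht0 : t ≠ 0 := fun h => hne (Or.inl (congrArg e h))
    have ht1 : t ≠ 1 := fun h => hne (Or.inr (congrArg e h))
    exact not_hasSmallBoundaries_one_of_mem_Ioo e.continuous e.injective
      (e.isOpenMap _ isOpen_Ioo)
      ⟨unitInterval.pos_iff_ne_zero.2 ht0, unitInterval.lt_one_iff_ne_one.2 ht1⟩ h1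
  · rintro (rfl | rfl)
    · exact ⟨hasSmallBoundaries_one_of_isOpen_image_Iio e.continuous e.injective
        (e.isOpenMap _ isOpen_Iio), not_hasSmallBoundaries_zero _⟩
    · exact ⟨hasSmallBoundaries_one_of_isOpen_image_Ioi e.continuous e.injective
        (e.isOpenMap _ isOpen_Ioi), not_hasSmallBoundaries_zero _⟩

theorem IsArc.exists_param {α : Set X} (h : IsArc α) :
    ∃ g : I → X, Continuous g ∧ Function.Injective g ∧ range g = α := by
  obtain ⟨e⟩ := h
  refine ⟨fun t => e t, continuous_subtype_val.comp e.continuous,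
    Subtype.val_injective.comp e.injective, ?_⟩
  change range (Subtype.val ∘ e) = α
  rw [e.surjective.range_comp, Subtype.range_val]

theorem isArc_range [T2Space X] (hg : Continuous g) (hinj : Function.Injective g) : IsArc (range g) :=
  ⟨(hg.isClosedEmbedding hinj).isEmbedding.toHomeomorph⟩

theorem endpointsOf_range [T2Space X] (hg : Continuous g) (hinj : Function.Injective g) :
    endpointsOf (range g) = {g 0, g 1} := by
  rw [endpointsOf, endpoints_eq_pair (hg.isClosedEmbedding hinj).isEmbedding.toHomeomorph,
    image_pair]
  rfl

theorem arcInterior_range [T2Space X] (hg : Continuous g) (hinj : Function.Injective g) :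
    arcInterior (range g) = g '' Ioo 0 1 := by
  rw [arcInterior, endpointsOf_range hg hinj, ← image_pair, ← image_univ,
    ← image_sdiff hinj]
  congr 1
  ext t
  simp only [mem_sdiff, mem_univ, true_and, mem_insert_iff, mem_singleton_iff, not_or, mem_Ioo,
    unitInterval.pos_iff_ne_zero, unitInterval.lt_one_iff_ne_one]

theorem isFreeArc_range [T2Space X] (hg : Continuous g) (hinj : Function.Injective g)
    (ho : IsOpen (g '' Ioo 0 1)) : IsFreeArc (range g) :=
  ⟨isArc_range hg hinj, by rwa [arcInterior_range hg hinj]⟩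

theorem IsArc.countable_endpointsOf [T2Space X] {α : Set X} (h : IsArc α) : (endpointsOf α).Countable := by
  obtain ⟨g, hg, hinj, rfl⟩ := h.exists_param
  rw [endpointsOf_range hg hinj]
  exact (toFinite _).countable

theorem IsArc.isConnected {α : Set X} (h : IsArc α) : IsConnected α := by
  obtain ⟨g, hg, -, rfl⟩ := h.exists_param
  exact isConnected_range hg

theorem IsArc.isClosed [T2Space X] {α : Set X} (h : IsArc α) : IsClosed α := by
  obtain ⟨g, hg, -, rfl⟩ := h.exists_param
  exact (isCompact_range hg).isClosed

/-- A point in the interior of a free arc has order two. -/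
theorem IsFreeArc.order_two [T2Space X] {α : Set X} (h : IsFreeArc α) {x : X} (hx : x ∈ arcInterior α) :
    HasSmallBoundaries 2 x ∧ ¬ HasSmallBoundaries 1 x := by
  obtain ⟨g, hg, hinj, rfl⟩ := h.1.exists_param
  have ho := h.2
  rw [arcInterior_range hg hinj] at hx ho
  obtain ⟨t, ht, rfl⟩ := hx
  exact ⟨hasSmallBoundaries_two_of_mem_Ioo hg hinj ho ht,
    not_hasSmallBoundaries_one_of_mem_Ioo hg hinj ho ht⟩

/-- A nondegenerate subinterval of an arc parametrized by `g`. -/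
theorem exists_reparam (hg : Continuous g) (hinj : Function.Injective g) {s r : I} (hsr : s < r) :
    ∃ f : I → X, Continuous f ∧ Function.Injective f ∧ range f = g '' Icc s r ∧
      f '' Ioo 0 1 = g '' Ioo s r := by
  have hsr' : (s : ℝ) < r := hsr
  have hmem : ∀ t : I, (s : ℝ) + t * (r - s) ∈ Icc (0 : ℝ) 1 := by
    intro t
    have h1 := t.2.1
    have h2 := t.2.2
    have h3 := s.2.1
    have h4 := r.2.2
    constructor <;> nlinarith
  let φ : I → I := fun t => ⟨s + t * (r - s), hmem t⟩
  have hφ : Continuous φ := by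
    refine Continuous.subtype_mk ?_ _
    fun_prop
  have hφi : StrictMono φ := by
    intro t u htu
    have htu' : (t : ℝ) < u := htu
    change (s : ℝ) + t * (r - s) < s + u * (r - s)
    nlinarith
  have h0 : φ 0 = s := Subtype.ext (by simp [φ])
  have h1 : φ 1 = r := Subtype.ext (by simp [φ])
  have hsurj : ∀ u ∈ Icc s r, ∃ t, φ t = u := fun u hu =>
    (intermediate_value_univ 0 1 hφ (by rwa [h0, h1]) : u ∈ range φ)
  refine ⟨g ∘ φ, hg.comp hφ, hinj.comp hφi.injective, ?_, ?_⟩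
  · rw [range_comp]
    congr 1
    refine Subset.antisymm ?_ fun u hu => hsurj u hu
    rintro _ ⟨t, rfl⟩
    rw [← h0, ← h1]
    exact ⟨hφi.monotone t.2.1, hφi.monotone t.2.2⟩
  · rw [image_comp]
    congr 1
    ext u
    constructor
    · rintro ⟨t, ht, rfl⟩
      rw [← h0, ← h1]
      exact ⟨hφi ht.1, hφi ht.2⟩
    · intro hu
      obtain ⟨t, rfl⟩ := hsurj u (Ioo_subset_Icc_self hu)
      refine ⟨t, ⟨hφi.lt_iff_lt.1 (by rw [h0]; exact hu.1),
        hφi.lt_iff_lt.1 (by rw [h1]; exact hu.2)⟩, rfl⟩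

theorem isFreeArc_image_Icc [T2Space X] (hg : Continuous g) (hinj : Function.Injective g) {s r : I}
    (hsr : s < r) (ho : IsOpen (g '' Ioo s r)) :
    IsFreeArc (g '' Icc s r) ∧ arcInterior (g '' Icc s r) = g '' Ioo s r := by
  obtain ⟨f, hf, hfi, hr, hfo⟩ := exists_reparam hg hinj hsr
  rw [← hr, ← hfo]
  exact ⟨isFreeArc_range hf hfi (hfo ▸ ho), arcInterior_range hf hfi⟩

variable (X) in
/-- The set of points lying in the interior of a free arc. -/
def freeInterior : Set X :=
  ⋃₀ (arcInterior '' {α : Set X | IsFreeArc α})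

theorem mem_freeInterior {x : X} :
    x ∈ freeInterior X ↔ ∃ α, IsFreeArc α ∧ x ∈ arcInterior α := by
  simp [freeInterior]

theorem isOpen_freeInterior : IsOpen (freeInterior X) :=
  isOpen_sUnion (by rintro _ ⟨α, hα, rfl⟩; exact hα.2)

/-- Openness of the arc near a point is enough, because a short subarc around that point is then
free. -/
theorem arcInterior_inter_subset_freeInterior [T2Space X] {α O : Set X} (hα : IsArc α)
    (ho : IsOpen (arcInterior α ∩ O)) (hO : IsOpen O) : arcInterior α ∩ O ⊆ freeInterior X := by
  obtain ⟨g, hg, hinj, rfl⟩ := hα.exists_param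
  rw [arcInterior_range hg hinj] at ho ⊢
  rintro _ ⟨⟨t, ht, rfl⟩, htO⟩
  obtain ⟨s, r, htsr, hsr⟩ := (mem_nhds_iff_exists_Ioo_subset' ⟨0, ht.1⟩ ⟨1, ht.2⟩).1
    (((hO.preimage hg).inter (isOpen_Ioo (a := (0 : I)) (b := 1))).mem_nhds ⟨htO, ht⟩)
  have ho' : IsOpen (g '' Ioo s r) := by
    refine isOpen_image_of_subset hg hinj (S := g ⁻¹' O ∩ Ioo 0 1) ?_ isOpen_Ioo hsr
    rwa [inter_comm, image_inter_preimage]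
  obtain ⟨h1, h2⟩ := isFreeArc_image_Icc hg hinj (htsr.1.trans htsr.2) ho'
  exact mem_freeInterior.2 ⟨_, h1, h2 ▸ mem_image_of_mem g htsr⟩

end Arcs

/-! ### Points of order two lie inside free arcs -/

section FreeInterior

theorem isClosed_connectedComponentIn {X : Type u} [TopologicalSpace X] {S : Set X} {x : X}
    (hS : IsClosed S) : IsClosed (connectedComponentIn S x) := by
  by_cases hx : x ∈ S
  · rw [connectedComponentIn_eq_image hx]
    exact hS.isClosedEmbedding_subtypeVal.isClosedMap _ isClosed_connectedComponent
  · rw [connectedComponentIn_eq_empty hx]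
    exact isClosed_empty

variable {X : Type u} [TopologicalSpace X] [T2Space X] [CompactSpace X]

theorem IsIrreducibleBetween.isFreeArc [TopologicalSpace.MetrizableSpace X] [PreconnectedSpace X]
    {a b : X} {K : Set X} (hK : IsIrreducibleBetween a b K) (hab : a ≠ b)
    (h2 : ∀ x ∈ K, HasSmallBoundaries 2 x) :
    IsFreeArc K ∧ arcInterior K = K \ {a, b} := by
  obtain ⟨g, hg, hinj, rfl, rfl, rfl⟩ := hK.exists_param hab h2
  have h : arcInterior (range g) = range g \ {g 0, g 1} := by
    rw [arcInterior, endpointsOf_range hg hinj]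
  exact ⟨⟨isArc_range hg hinj, h ▸ hK.isOpen_diff h2⟩, h⟩

/-- If the arc `K` is a neighborhood of its end `a`, then `K \ {b}` is open, and short half-open
arcs at `a` have one boundary point. -/
theorem IsIrreducibleBetween.hasSmallBoundaries_one [TopologicalSpace.MetrizableSpace X]
    [PreconnectedSpace X] {a b : X} {K : Set X} (hK : IsIrreducibleBetween a b K) (hab : a ≠ b)
    (h2 : ∀ x ∈ K, HasSmallBoundaries 2 x) (hKa : K ∈ 𝓝 a) : HasSmallBoundaries 1 a := by
  have hopen : IsOpen (K \ {b}) := by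
    have : K \ {b} = K \ {a, b} ∪ interior K \ {b} := by
      ext z
      by_cases hz : z = a
      · subst hz
        simp [hab, hK.left_mem, mem_interior_iff_mem_nhds.2 hKa]
      · have := @interior_subset _ _ K z
        simp only [mem_sdiff, mem_singleton_iff, mem_union, mem_insert_iff]
        tauto
    rw [this]
    exact (hK.isOpen_diff h2).union (isOpen_interior.sdiff isClosed_singleton)
  obtain ⟨g, hg, hinj, hr, h0, h1⟩ := hK.exists_param hab h2
  rw [← h0]
  refine hasSmallBoundaries_one_of_isOpen_image_Iio hg hinj ?_
  convert hopen
  rw [← hr, ← h1, ← image_singleton, ← image_univ, ← image_sdiff hinj]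
  congr 1
  ext t
  simp [unitInterval.lt_one_iff_ne_one]

/-- If the component of `x` in a closed set `Z` is degenerate, and `Z` minus `x` is open in the
space near `x`, then `x` is isolated in `Z`. -/
theorem exists_nhds_inter_subset_of_component_subsingleton [PreconnectedSpace X] {V Z : Set X}
    {x : X} (hV : IsOpen V) (hxV : x ∈ V) (hxZ : x ∈ Z) (hZ : IsClosed Z)
    (hVZ : IsOpen ((V ∩ Z) \ {x})) (hsing : connectedComponentIn Z x ⊆ {x}) :
    ∃ O, IsOpen O ∧ x ∈ O ∧ O ∩ Z ⊆ {x} := by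
  obtain ⟨T, hTZ, hxT, hT, W, hW, hTW⟩ := exists_isClopen_of_connectedComponentIn_subset hZ hxZ
    hV (hsing.trans (singleton_subset_iff.2 hxV))
  have hTx : IsOpen (T \ {x}) := by
    have : T \ {x} = ((V ∩ Z) \ {x}) ∩ W := by
      ext z
      constructor
      · rintro ⟨hz, hzx⟩
        exact ⟨⟨⟨(hTZ hz).2, (hTZ hz).1⟩, hzx⟩, (hTW.subset hz).2⟩
      · rintro ⟨⟨⟨h1, h2⟩, hzx⟩, h3⟩
        exact ⟨hTW.superset ⟨h2, h3⟩, hzx⟩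
    rw [this]
    exact hVZ.inter hW
  -- A second point `y` of `T` could be split off from `x`; the part containing `y` would be clopen
  -- in the connected space, yet miss `x`.
  have hTsing : T ⊆ {x} := by
    intro y hy
    by_contra hyx
    obtain ⟨T', hT'T, hxT', hT', W', hW', hTW'⟩ :=
      exists_isClopen_of_connectedComponentIn_subset hT hxT (isOpen_compl_singleton (x := y))
        (((connectedComponentIn_mono x (hTZ.trans inter_subset_left)).trans hsing).trans
          (singleton_subset_iff.2 fun h => hyx h.symm))
    have h1 : T \ T' = T \ W' := by rw [hTW', sdiff_self_inter]
    have h2 : T \ T' = (T \ {x}) \ T' := by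
      ext z
      constructor
      · rintro ⟨hz, hz'⟩
        exact ⟨⟨hz, fun h => hz' (mem_singleton_iff.1 h ▸ hxT')⟩, hz'⟩
      · rintro ⟨⟨hz, -⟩, hz'⟩
        exact ⟨hz, hz'⟩
    have hclopen : IsClopen (T \ T') := ⟨h1 ▸ hT.sdiff hW', h2 ▸ hTx.sdiff hT'⟩
    have := hclopen.eq_univ ⟨y, hy, fun h => (hT'T h).2 rfl⟩
    exact (this.superset (mem_univ x)).2 hxT'
  refine ⟨W, hW, (hTW.subset hxT).2, fun z hz => hTsing (hTW.superset ⟨hz.2, hz.1⟩)⟩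

/-- A free arc `K` starts at `x`. As `x` has order greater than one, `K` is not a neighborhood of
`x`, so a second nondegenerate continuum leaves `x`, meeting `K` only there. An irreducible
continuum in the union of the two is a free arc with `x` in its interior. -/
theorem mem_freeInterior_of_hasSmallBoundaries [TopologicalSpace.MetrizableSpace X]
    [PreconnectedSpace X] [Nontrivial X] {U : Set X} (hU : IsOpen U)
    (h2 : ∀ x ∈ U, HasSmallBoundaries 2 x) {x : X} (hx : x ∈ U)
    (h1 : ¬ HasSmallBoundaries 1 x) : x ∈ freeInterior X := by
  obtain ⟨y, hy⟩ := exists_ne x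
  obtain ⟨V, hV, hxV, hVU, -⟩ := (h2 x hx).exists_closure_subset
    (hU.inter (isOpen_compl_singleton (x := y))) ⟨hx, hy.symm⟩
  obtain ⟨b, hbC, hbf⟩ := connectedComponentIn_inter_frontier_nonempty
    (isClosed_closure (s := V)) (subset_closure hxV)
    (fun h => (hVU (h.superset (mem_univ y))).2 rfl)
  have hxb : x ≠ b := by
    rintro rfl
    exact hbf.2 (interior_mono subset_closure (hV.interior_eq.superset hxV))
  obtain ⟨K, hKC, hK⟩ := exists_isIrreducibleBetween
    (isClosed_connectedComponentIn isClosed_closure) isPreconnected_connectedComponentIn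
    (mem_connectedComponentIn (subset_closure hxV)) hbC
  have hKU : K ⊆ U := fun z hz => (hVU (connectedComponentIn_subset _ _ (hKC hz))).1
  have hK2 : ∀ z ∈ K, HasSmallBoundaries 2 z := fun z hz => h2 z (hKU hz)
  obtain ⟨V', hV', hxV', hVU', -⟩ := (h2 x hx).exists_closure_subset
    (hU.inter (isOpen_compl_singleton (x := b))) ⟨hx, hxb⟩
  -- `Z` is a closed neighborhood of `x` with the open arc removed, so it meets `K` only in `x`.
  set Z := closure V' \ (K \ {x, b}) with hZdef
  have hZ : IsClosed Z := isClosed_closure.sdiff (hK.isOpen_diff hK2)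
  have hxZ : x ∈ Z := ⟨subset_closure hxV', fun h => h.2 (Or.inl rfl)⟩
  have hZK : ∀ z ∈ Z, z ∈ K → z = x := by
    intro z hz hzK
    by_contra hzx
    refine hz.2 ⟨hzK, ?_⟩
    rintro (h | h)
    exacts [hzx h, (hVU' hz.1).2 h]
  have hVZ : (V' ∩ Z) \ {x} = V' \ K := by
    ext z
    constructor
    · rintro ⟨⟨hzV, hzZ⟩, hzx⟩
      exact ⟨hzV, fun h => hzx (hZK z hzZ h)⟩
    · rintro ⟨hzV, hzK⟩
      exact ⟨⟨hzV, subset_closure hzV, fun h => hzK h.1⟩,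
        fun h => hzK (mem_singleton_iff.1 h ▸ hK.left_mem)⟩
  have hnon : ¬ connectedComponentIn Z x ⊆ {x} := by
    intro hsing
    obtain ⟨O, hO, hxO, hOZ⟩ := exists_nhds_inter_subset_of_component_subsingleton hV' hxV' hxZ hZ
      (hVZ ▸ hV'.sdiff hK.isClosed) hsing
    refine h1 (hK.hasSmallBoundaries_one hxb hK2 ?_)
    refine Filter.mem_of_superset ((hO.inter hV').mem_nhds ⟨hxO, hxV'⟩) fun z hz => ?_
    by_contra hzK
    have := hVZ.superset ⟨hz.2, hzK⟩
    exact this.2 (hOZ ⟨hz.1, this.1.2⟩)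
  obtain ⟨c, hcM, hcx⟩ := not_subset.1 hnon
  have hMZ : connectedComponentIn Z x ⊆ Z := connectedComponentIn_subset _ _
  have hxM : x ∈ connectedComponentIn Z x := mem_connectedComponentIn hxZ
  have hM : IsClosed (connectedComponentIn Z x) := isClosed_connectedComponentIn hZ
  obtain ⟨L, hLN, hL⟩ := exists_isIrreducibleBetween (hM.union hK.isClosed)
    (isPreconnected_connectedComponentIn.union x hxM hK.left_mem hK.isPreconnected)
    (Or.inl hcM) (Or.inr hK.right_mem)
  have hL2 : ∀ z ∈ L, HasSmallBoundaries 2 z := fun z hz => h2 z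
    ((hLN hz).elim (fun h => (hVU' (hMZ h).1).1) fun h => hKU h)
  have hcb : c ≠ b := (hVU' (hMZ hcM).1).2
  obtain ⟨hfree, hint⟩ := hL.isFreeArc hcb hL2
  -- `L` is connected and meets both closed pieces covering it, hence also their intersection, which
  -- is only `x`.
  have hxL : x ∈ L := by
    obtain ⟨z, hzL, hzM, hzK⟩ := isPreconnected_closed_iff.1 hL.isPreconnected _ _ hM hK.isClosed
      hLN ⟨c, hL.left_mem, hcM⟩ ⟨b, hL.right_mem, hK.right_mem⟩
    exact hZK z (hMZ hzM) hzK ▸ hzL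
  refine mem_freeInterior.2 ⟨L, hfree, hint.superset ⟨hxL, ?_⟩⟩
  rintro (h | h)
  exacts [hcx h.symm, hxb h]

theorem IsTameGraph.countable_compl_freeInterior [TopologicalSpace.MetrizableSpace X]
    [PreconnectedSpace X] (h : IsTameGraph X) : ((freeInterior X)ᶜ).Countable := by
  -- In a one-point space the order is zero, so the exclusion of order zero below needs a second
  -- point.
  cases subsingleton_or_nontrivial X
  · exact (subsingleton_of_subsingleton).countable
  refine h.mono fun x hx => ?_
  by_contra hcl
  have hE : ∀ z ∈ (closure (endpoints X ∪ branchpoints X))ᶜ,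
      HasSmallBoundaries 2 z ∧ ¬ HasSmallBoundaries 1 z := by
    intro z hz
    have hz' : z ∉ endpoints X ∪ branchpoints X := fun h => hz (subset_closure h)
    rw [mem_union, mem_endpoints_iff, mem_branchpoints_iff, not_or, not_not, not_and_not_right]
      at hz'
    exact ⟨hz'.2, fun h => not_hasSmallBoundaries_zero z (hz'.1 h)⟩
  exact hx (mem_freeInterior_of_hasSmallBoundaries isClosed_closure.isOpen_compl
    (fun z hz => (hE z hz).1) hcl (hE x hcl).2)

end FreeInterior

/-! ### The conditions in terms of the free interior -/

section Equivalences

variable {X : Type u} [TopologicalSpace X]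

theorem isTameGraph_of_countable_compl_freeInterior [T2Space X] (h : ((freeInterior X)ᶜ).Countable) :
    IsTameGraph X := by
  refine h.mono (closure_minimal ?_ isOpen_freeInterior.isClosed_compl)
  intro x hx hxW
  obtain ⟨α, hα, hxα⟩ := mem_freeInterior.1 hxW
  obtain ⟨h2, h1⟩ := hα.order_two hxα
  rcases hx with hx | hx
  · exact h1 ((mem_endpoints_iff x).1 hx).1
  · exact (mem_branchpoints_iff x).1 hx h2

theorem countable_compl_freeInterior_of_cover [T2Space X] {𝒜 : Set (Set X)} {C : Set X} (h𝒜 : 𝒜.Countable)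
    (hfree : ∀ α ∈ 𝒜, IsFreeArc α) (hC : C.Countable) (hcov : ⋃₀ 𝒜 ∪ C = univ) :
    ((freeInterior X)ᶜ).Countable := by
  refine (hC.union (h𝒜.biUnion fun α hα => (hfree α hα).1.countable_endpointsOf)).mono ?_
  intro x hx
  rcases hcov.superset (mem_univ x) with ⟨α, hα, hxα⟩ | h
  · refine Or.inr (mem_biUnion hα ?_)
    by_contra hcon
    exact hx (mem_freeInterior.2 ⟨α, hfree α hα, hxα, hcon⟩)
  · exact Or.inl h

theorem exists_countable_freeArcs [SecondCountableTopology X] :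
    ∃ 𝒜 : Set (Set X), 𝒜.Countable ∧ (∀ α ∈ 𝒜, IsFreeArc α) ∧
      ⋃ α ∈ 𝒜, arcInterior α = freeInterior X := by
  obtain ⟨T, hT, hTc, hTU⟩ := TopologicalSpace.isOpen_biUnion_countable
    {α : Set X | IsFreeArc α} arcInterior fun α hα => hα.2
  refine ⟨T, hTc, fun α hα => hT hα, ?_⟩
  rw [hTU, freeInterior, sUnion_image]

theorem isFiniteGraph_of_isArc {α : Set X} (h : IsArc α) : IsFiniteGraph α := by
  refine ⟨h.isConnected, {α}, finite_singleton α, ?_, ?_, sUnion_singleton α⟩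
  · rintro _ rfl
    exact h
  · rintro _ rfl _ rfl hne
    exact (hne rfl).elim

/-- Apart from the finitely many arc endpoints, an interior point lies on only one arc. Removing the
other closed arcs leaves an open set in which the graph coincides with this arc. -/
theorem IsFiniteGraph.countable_interior_diff [T2Space X] {N : Set X} (h : IsFiniteGraph N) :
    (interior N \ freeInterior X).Countable := by
  obtain ⟨-, 𝒜, hfin, harc, hinter, rfl⟩ := h
  refine (hfin.countable.biUnion fun α hα => (harc α hα).countable_endpointsOf).mono ?_
  rintro x ⟨hxN, hxW⟩
  obtain ⟨α, hα, hxα⟩ := interior_subset hxN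
  refine mem_biUnion hα ?_
  by_contra hxE
  have hO : IsOpen (interior (⋃₀ 𝒜) \ ⋃ β ∈ 𝒜 \ {α}, β) :=
    isOpen_interior.sdiff (hfin.sdiff.isClosed_biUnion fun β hβ => (harc β hβ.1).isClosed)
  have heq : arcInterior α ∩ (interior (⋃₀ 𝒜) \ ⋃ β ∈ 𝒜 \ {α}, β) =
      (interior (⋃₀ 𝒜) \ ⋃ β ∈ 𝒜 \ {α}, β) \ endpointsOf α := by
    ext z
    constructor
    · rintro ⟨hz, hzO⟩
      exact ⟨hzO, hz.2⟩
    · rintro ⟨hzO, hzE⟩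
      refine ⟨⟨?_, hzE⟩, hzO⟩
      obtain ⟨β, hβ, hzβ⟩ := interior_subset hzO.1
      by_contra hzα
      exact hzO.2 (mem_biUnion ⟨hβ, fun h => hzα (mem_singleton_iff.1 h ▸ hzβ)⟩ hzβ)
  refine hxW (arcInterior_inter_subset_freeInterior (harc α hα) (heq ▸ hO.sdiff ?_) hO
    ⟨⟨hxα, hxE⟩, hxN, ?_⟩)
  · intro hx
    obtain ⟨β, ⟨hβ, hne⟩, hxβ⟩ := mem_iUnion₂.1 hx
    exact hxE (hinter α hα β hβ (fun h => hne h.symm) ⟨hxα, hxβ⟩).1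
  · obtain ⟨g, hg, hinj, rfl⟩ := (harc α hα).exists_param
    rw [endpointsOf_range hg hinj]
    exact (toFinite _).isClosed

theorem countable_compl_freeInterior_of_finiteGraph_nhds [T2Space X] [SecondCountableTopology X]
    (h : {x : X | ¬ ∃ N ∈ 𝓝 x, IsFiniteGraph N}.Countable) :
    ((freeInterior X)ᶜ).Countable := by
  obtain ⟨T, hT, hTc, hTU⟩ := TopologicalSpace.isOpen_biUnion_countable
    {N : Set X | IsFiniteGraph N} interior fun N _ => isOpen_interior
  refine (h.union (hTc.biUnion fun N hN => (hT hN).countable_interior_diff)).mono ?_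
  intro x hx
  by_cases hxN : ∃ N ∈ 𝓝 x, IsFiniteGraph N
  · obtain ⟨N, hN, hNf⟩ := hxN
    have : x ∈ ⋃ N ∈ T, interior N := hTU ▸ mem_biUnion hNf (mem_interior_iff_mem_nhds.2 hN)
    obtain ⟨N', hN', hxN'⟩ := mem_iUnion₂.1 this
    exact Or.inr (mem_biUnion hN' ⟨hxN', hx⟩)
  · exact Or.inl hxN

theorem countable_setOf_not_finiteGraph_nhds (h : ((freeInterior X)ᶜ).Countable) :
    {x : X | ¬ ∃ N ∈ 𝓝 x, IsFiniteGraph N}.Countable := by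
  refine h.mono ?_
  intro x hx hxW
  obtain ⟨α, hα, hxα⟩ := mem_freeInterior.1 hxW
  exact hx ⟨α, Filter.mem_of_superset (hα.2.mem_nhds hxα) sdiff_subset,
    isFiniteGraph_of_isArc hα.1⟩

end Equivalences

/-! ### Nonoverlapping dyadic intervals -/

section Dyadic

/-- The coarser floor is the finer one after integer division by `2 ^ (n - m)`, so a dyadic interval
determines all coarser ones around it. -/
theorem floor_two_pow_mul_eq_of_le {y z : ℝ} {m n : ℕ} (hmn : m ≤ n)
    (h : ⌊(2 : ℝ) ^ n * z⌋ = ⌊(2 : ℝ) ^ n * y⌋) : ⌊(2 : ℝ) ^ m * z⌋ = ⌊(2 : ℝ) ^ m * y⌋ := by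
  have key : ∀ w : ℝ, ⌊(2 : ℝ) ^ m * w⌋ = ⌊(2 : ℝ) ^ n * w⌋ / ((2 ^ (n - m) : ℕ) : ℤ) := by
    intro w
    rw [← Int.floor_div_natCast]
    congr 1
    obtain ⟨k, rfl⟩ := Nat.exists_eq_add_of_le hmn
    rw [Nat.add_sub_cancel_left, pow_add]
    push_cast
    field_simp
  rw [key z, key y, h]

/-- The dyadic interval of length `2⁻ⁿ` starting at the largest dyadic rational below `y`. -/
noncomputable def dyadicInterval (n : ℕ) (y : ℝ) : ℝ × ℝ :=
  (⌊(2 : ℝ) ^ n * y⌋ / 2 ^ n, (⌊(2 : ℝ) ^ n * y⌋ + 1) / 2 ^ n)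

theorem mem_Icc_dyadicInterval (n : ℕ) (y : ℝ) :
    y ∈ Icc (dyadicInterval n y).1 (dyadicInterval n y).2 := by
  have h2 : (0 : ℝ) < 2 ^ n := by positivity
  refine ⟨(div_le_iff₀ h2).2 ?_, (le_div_iff₀ h2).2 ?_⟩
  · rw [mul_comm y]
    exact Int.floor_le _
  · rw [mul_comm y]
    exact (Int.lt_floor_add_one _).le

theorem floor_eq_of_mem_Ioo_dyadicInterval {n : ℕ} {y z : ℝ}
    (hz : z ∈ Ioo (dyadicInterval n y).1 (dyadicInterval n y).2) :
    ⌊(2 : ℝ) ^ n * z⌋ = ⌊(2 : ℝ) ^ n * y⌋ := by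
  have h2 : (0 : ℝ) < 2 ^ n := by positivity
  rw [Int.floor_eq_iff, mul_comm _ z]
  exact ⟨((div_lt_iff₀ h2).1 hz.1).le, (lt_div_iff₀ h2).1 hz.2⟩

theorem exists_dyadicInterval_subset {O : Set ℝ} (hO : IsOpen O) {y : ℝ} (hy : y ∈ O) :
    ∃ n, Icc (dyadicInterval n y).1 (dyadicInterval n y).2 ⊆ O := by
  obtain ⟨ε, hε, hball⟩ := Metric.isOpen_iff.1 hO y hy
  obtain ⟨n, hn⟩ := exists_pow_lt_of_lt_one hε (by norm_num : (1 / 2 : ℝ) < 1)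
  refine ⟨n, fun z hz => hball ?_⟩
  have hy' := mem_Icc_dyadicInterval n y
  have hlen : (dyadicInterval n y).2 = (dyadicInterval n y).1 + (1 / 2) ^ n := by
    simp only [dyadicInterval, add_div, one_div, inv_pow]
  rw [Metric.mem_ball, Real.dist_eq, abs_lt]
  rw [hlen] at hz hy'
  constructor <;> linarith [hz.1, hz.2, hy'.1, hy'.2]

/-- An open set of reals is a union of countably many nonoverlapping closed intervals. -/
theorem exists_nonoverlapping_intervals {O : Set ℝ} (hO : IsOpen O) :
    ∃ F : Set (ℝ × ℝ), F.Countable ∧ (∀ p ∈ F, p.1 < p.2 ∧ Icc p.1 p.2 ⊆ O) ∧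
      (∀ p ∈ F, ∀ q ∈ F, p ≠ q → Disjoint (Ioo p.1 p.2) (Ioo q.1 q.2)) ∧
      O ⊆ ⋃ p ∈ F, Icc p.1 p.2 := by
  classical
  have hex : ∀ y : O, ∃ n, Icc (dyadicInterval n (y : ℝ)).1 (dyadicInterval n (y : ℝ)).2 ⊆ O :=
    fun y => exists_dyadicInterval_subset hO y.2
  have hsame : ∀ {m n : ℕ} {y z : ℝ}, m ≤ n →
      z ∈ Ioo (dyadicInterval n y).1 (dyadicInterval n y).2 → dyadicInterval m z = dyadicInterval m y := by
    intro m n y z hmn hz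
    rw [dyadicInterval, dyadicInterval,
      floor_two_pow_mul_eq_of_le hmn (floor_eq_of_mem_Ioo_dyadicInterval hz)]
  -- Each `y` selects the largest dyadic interval around it inside `O`. Interior points of that
  -- interval share its coarser levels and so select the same one, whence different selections do
  -- not overlap.
  have hzO : ∀ (y : O) (z : ℝ), z ∈ Ioo (dyadicInterval (Nat.find (hex y)) (y : ℝ)).1
      (dyadicInterval (Nat.find (hex y)) (y : ℝ)).2 → ∃ z' : O, (z' : ℝ) = z ∧
      dyadicInterval (Nat.find (hex z')) (z' : ℝ) = dyadicInterval (Nat.find (hex y)) (y : ℝ) := by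
    intro y z hz
    refine ⟨⟨z, Nat.find_spec (hex y) (Ioo_subset_Icc_self hz)⟩, rfl, ?_⟩
    have hfind : Nat.find (hex ⟨z, Nat.find_spec (hex y) (Ioo_subset_Icc_self hz)⟩) =
        Nat.find (hex y) := by
      rw [Nat.find_eq_iff]
      refine ⟨?_, fun m hm => ?_⟩
      · rw [hsame le_rfl hz]
        exact Nat.find_spec (hex y)
      · rw [hsame hm.le hz]
        exact Nat.find_min (hex y) hm
    rw [hfind]
    exact hsame le_rfl hz
  refine ⟨range fun y : O => dyadicInterval (Nat.find (hex y)) (y : ℝ), ?_, ?_, ?_, ?_⟩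
  · refine (countable_range fun k : ℕ × ℤ =>
      ((k.2 / 2 ^ k.1, (k.2 + 1) / 2 ^ k.1) : ℝ × ℝ)).mono ?_
    rintro _ ⟨y, rfl⟩
    exact ⟨(Nat.find (hex y), ⌊(2 : ℝ) ^ Nat.find (hex y) * (y : ℝ)⌋), rfl⟩
  · rintro _ ⟨y, rfl⟩
    refine ⟨?_, Nat.find_spec (hex y)⟩
    exact div_lt_div_of_pos_right (lt_add_one _) (by positivity)
  · rintro _ ⟨y, rfl⟩ _ ⟨y', rfl⟩ hne
    rw [disjoint_left]
    intro z hz hz'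
    obtain ⟨w, hw, hwe⟩ := hzO y z hz
    obtain ⟨w', hw', hwe'⟩ := hzO y' z hz'
    obtain rfl : w = w' := Subtype.ext (hw.trans hw'.symm)
    exact hne (hwe.symm.trans hwe')
  · intro y hy
    exact mem_biUnion ⟨⟨y, hy⟩, rfl⟩ (mem_Icc_dyadicInterval _ _)

theorem exists_nonoverlapping_unitIntervals {O : Set I} (hO : IsOpen O) (hO01 : O ⊆ Ioo 0 1) :
    ∃ F : Set (I × I), F.Countable ∧ (∀ p ∈ F, p.1 < p.2 ∧ Icc p.1 p.2 ⊆ O) ∧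
      (∀ p ∈ F, ∀ q ∈ F, p ≠ q → Disjoint (Ioo p.1 p.2) (Ioo q.1 q.2)) ∧
      O ⊆ ⋃ p ∈ F, Icc p.1 p.2 := by
  -- Avoiding 0 and 1 makes `O` open in the reals, not only in `I`.
  have hO' : IsOpen (Subtype.val '' O : Set ℝ) := by
    obtain ⟨W, hW, rfl⟩ := isOpen_induced_iff.1 hO
    have : (Subtype.val '' (Subtype.val ⁻¹' W : Set I) : Set ℝ) = W ∩ Ioo 0 1 := by
      ext t
      constructor
      · rintro ⟨t, ht, rfl⟩
        exact ⟨ht, hO01 ht⟩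
      · rintro ⟨htW, ht⟩
        exact ⟨⟨t, ht.1.le, ht.2.le⟩, htW, rfl⟩
    rw [this]
    exact hW.inter isOpen_Ioo
  obtain ⟨F, hFc, hF, hFd, hFO⟩ := exists_nonoverlapping_intervals hO'
  have hinj : Function.Injective fun p : I × I => ((p.1, p.2) : ℝ × ℝ) :=
    Subtype.val_injective.prodMap Subtype.val_injective
  refine ⟨(fun p : I × I => ((p.1, p.2) : ℝ × ℝ)) ⁻¹' F, hFc.preimage hinj, ?_, ?_, ?_⟩
  · intro p hp
    obtain ⟨h1, h2⟩ := hF _ hp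
    refine ⟨h1, fun t ht => ?_⟩
    obtain ⟨t', ht', he⟩ := h2 (show (t : ℝ) ∈ Icc (p.1 : ℝ) p.2 from ht)
    exact Subtype.ext he ▸ ht'
  · intro p hp q hq hne
    rw [disjoint_left]
    intro t ht ht'
    exact disjoint_left.1 (hFd _ hp _ hq (hinj.ne hne))
      (show (t : ℝ) ∈ Ioo (p.1 : ℝ) p.2 from ht) ht'
  · intro t ht
    obtain ⟨p, hp, htp⟩ := mem_iUnion₂.1 (hFO (mem_image_of_mem _ ht))
    obtain ⟨h1, h2⟩ := hF _ hp
    obtain ⟨s, -, hs⟩ := h2 ⟨le_rfl, h1.le⟩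
    obtain ⟨r, -, hr⟩ := h2 ⟨h1.le, le_rfl⟩
    refine mem_biUnion (x := (s, r)) ?_ ⟨?_, ?_⟩
    · change ((s : ℝ), (r : ℝ)) ∈ F
      rw [hs, hr]
      exact hp
    · exact Subtype.coe_le_coe.1 (hs ▸ htp.1)
    · exact Subtype.coe_le_coe.1 (hr ▸ htp.2)

end Dyadic

/-! ### Construction of a tame partition -/

section TamePartition

variable {X : Type u} [TopologicalSpace X] [T2Space X]

/-- An open subset of the interior of a free arc is covered by countably many nonoverlapping free
arcs contained in it. -/
theorem IsFreeArc.exists_partition {α O : Set X} (hα : IsFreeArc α) (hO : IsOpen O)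
    (hOα : O ⊆ arcInterior α) :
    ∃ P : Set (Set X), P.Countable ∧ (∀ β ∈ P, IsFreeArc β ∧ β ⊆ O) ∧
      (∀ β ∈ P, ∀ γ ∈ P, β ≠ γ → Disjoint (arcInterior β) (arcInterior γ)) ∧ O ⊆ ⋃₀ P := by
  obtain ⟨g, hg, hinj, rfl⟩ := hα.1.exists_param
  have hopen := hα.2
  rw [arcInterior_range hg hinj] at hOα hopen
  obtain ⟨F, hFc, hF, hFd, hFO⟩ := exists_nonoverlapping_unitIntervals (hO.preimage hg)
    (fun t ht => (hinj.mem_set_image).1 (hOα ht))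
  have hfree : ∀ p ∈ F, IsFreeArc (g '' Icc p.1 p.2) ∧
      arcInterior (g '' Icc p.1 p.2) = g '' Ioo p.1 p.2 := fun p hp =>
    isFreeArc_image_Icc hg hinj (hF p hp).1 (isOpen_image_of_subset hg hinj hopen isOpen_Ioo
      (Ioo_subset_Ioo p.1.2.1 p.2.2.2))
  refine ⟨(fun p : I × I => g '' Icc p.1 p.2) '' F, hFc.image _, ?_, ?_, ?_⟩
  · rintro _ ⟨p, hp, rfl⟩
    exact ⟨(hfree p hp).1, image_subset_iff.2 (hF p hp).2⟩
  · rintro _ ⟨p, hp, rfl⟩ _ ⟨q, hq, rfl⟩ hne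
    dsimp only
    rw [(hfree p hp).2, (hfree q hq).2, disjoint_image_iff hinj]
    exact hFd p hp q hq fun h => hne (h ▸ rfl)
  · intro x hx
    obtain ⟨t, -, rfl⟩ := hOα hx
    obtain ⟨p, hp, htp⟩ := mem_iUnion₂.1 (hFO hx)
    exact ⟨_, mem_image_of_mem _ hp, mem_image_of_mem g htp⟩

theorem exists_isTamePartition [SecondCountableTopology X] (h : ((freeInterior X)ᶜ).Countable) :
    ∃ P : Set (Set X), IsTamePartition P := by
  classical
  obtain ⟨𝒜, h𝒜c, h𝒜, h𝒜U⟩ := exists_countable_freeArcs (X := X)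
  rcases 𝒜.eq_empty_or_nonempty with rfl | hne
  · refine ⟨∅, countable_empty, by simp, by simp, ?_⟩
    rw [← h𝒜U] at h
    simpa using h
  obtain ⟨α, hα⟩ := h𝒜c.exists_eq_range hne
  have hfree : ∀ n, IsFreeArc (α n) := fun n => h𝒜 _ (hα ▸ mem_range_self n)
  -- Removing the earlier arcs makes the open sets disjoint; the arcs subdividing different `O n`
  -- then cannot overlap.
  set O : ℕ → Set X := fun n => arcInterior (α n) \ ⋃ k ∈ Iio n, α k with hOdef
  have hO : ∀ n, IsOpen (O n) := fun n => (hfree n).2.sdiff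
    ((finite_Iio n).isClosed_biUnion fun k _ => (hfree k).1.isClosed)
  have hdisj : ∀ m n, m < n → Disjoint (O m) (O n) := by
    intro m n hmn
    rw [disjoint_left]
    intro x hx hx'
    exact hx'.2 (mem_biUnion hmn hx.1.1)
  choose P hPc hP hPd hPO using fun n => (hfree n).exists_partition (hO n) sdiff_subset
  refine ⟨⋃ n, P n, countable_iUnion hPc, ?_, ?_, ?_⟩
  · intro β hβ
    obtain ⟨n, hn⟩ := mem_iUnion.1 hβ
    exact (hP n β hn).1
  · intro β hβ γ hγ hne
    obtain ⟨m, hm⟩ := mem_iUnion.1 hβ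
    obtain ⟨n, hn⟩ := mem_iUnion.1 hγ
    have h1 : arcInterior β ⊆ O m := sdiff_subset.trans (hP m β hm).2
    have h2 : arcInterior γ ⊆ O n := sdiff_subset.trans (hP n γ hn).2
    rcases lt_trichotomy m n with hmn | rfl | hmn
    · exact (hdisj m n hmn).mono h1 h2
    · exact hPd m β hm γ hn hne
    · exact (hdisj n m hmn).symm.mono h1 h2
  · refine (h.union (countable_iUnion fun n => (hfree n).1.countable_endpointsOf)).mono ?_
    intro x hx
    by_cases hxW : x ∈ freeInterior X
    · right
      have hex : ∃ n, x ∈ α n := by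
        rw [← h𝒜U] at hxW
        obtain ⟨β, hβ, hxβ⟩ := mem_iUnion₂.1 hxW
        obtain ⟨n, rfl⟩ := hα.subset hβ
        exact ⟨n, hxβ.1⟩
      -- On the first arc containing it, `x` is either an endpoint or a point of the corresponding
      -- `O n`, which the subarcs cover.
      refine mem_iUnion.2 ⟨Nat.find hex, ?_⟩
      by_contra hxE
      have hxO : x ∈ O (Nat.find hex) := by
        refine ⟨⟨Nat.find_spec hex, hxE⟩, fun hcon => ?_⟩
        obtain ⟨k, hk, hxk⟩ := mem_iUnion₂.1 hcon
        exact Nat.find_min hex hk hxk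
      obtain ⟨β, hβ, hxβ⟩ := hPO _ hxO
      exact hx ⟨β, mem_iUnion.2 ⟨_, hβ⟩, hxβ⟩
    · exact Or.inl hxW

end TamePartition

end TameGraph

theorem mainTheorem11 (G : Type u) [TopologicalSpace G] [TopologicalSpace.MetrizableSpace G]
    [CompactSpace G] [ConnectedSpace G] :
    List.TFAE
      [TameGraph.IsTameGraph G,
       ∃ (𝒜 : Set (Set G)) (C : Set G), 𝒜.Countable ∧ (∀ α ∈ 𝒜, TameGraph.IsFreeArc α) ∧
         C.Countable ∧ ⋃₀ 𝒜 ∪ C = univ,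
       ∃ P : Set (Set G), TameGraph.IsTamePartition P,
       {x : G | ¬ ∃ N ∈ 𝓝 x, TameGraph.IsFiniteGraph N}.Countable] := by
  have : SecondCountableTopology G := by
    let _ : MetricSpace G := TopologicalSpace.metrizableSpaceMetric G
    infer_instance
  tfae_have 1 → 3 := fun h => TameGraph.exists_isTamePartition h.countable_compl_freeInterior
  tfae_have 3 → 2 := by
    rintro ⟨P, h1, h2, -, h4⟩
    exact ⟨P, _, h1, h2, h4, union_compl_self _⟩
  tfae_have 2 → 4 := by
    rintro ⟨𝒜, C, h1, h2, h3, h4⟩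
    exact TameGraph.countable_setOf_not_finiteGraph_nhds
      (TameGraph.countable_compl_freeInterior_of_cover h1 h2 h3 h4)
  tfae_have 4 → 1 := fun h => TameGraph.isTameGraph_of_countable_compl_freeInterior
    (TameGraph.countable_compl_freeInterior_of_finiteGraph_nhds h)
  tfae_finish
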